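/- Let $n\ge 2$, $d\in\mathbb N$, $T>0$, $\mathbb T=\mathbb R/T\mathbb Z$, and let $m_1,\dots,m_n>0$. Let $$\mathcal X=\Big\{x\in(\mathbb R^d)^n:\ \sum_i m_ix_i=0\Big\},\qquad U(x)=\sum_{i<j}\frac{m_im_j}{\|x_i-x_j\|},$$ with $U=+\infty$ at collisions (i.e. when $x_i=x_j$ for some $i\ne j$), and $\Lambda=H^1(\mathbb T;\mathcal X)$; elements of $H^1$ are identified with their continuous representatives. Let $G$ be a finite group with homomorphisms $\rho:G\to O(d)$, $\tau:G\to O(2)$, $\sigma:G\to\Sigma_n$ such that $m_{\sigma(g)i}=m_i$ for all $g$ and $i$. Then $O(2)$ acts on $\mathbb T$, identified with the unit circle by $t\mapsto e^{2\pi i t/T}$, and $G$ acts on $\mathcal X$ by $(gx)_i=\rho(g)x_{\sigma(g^{-1})i}$ and on $\Lambda$ by $(gx)(t)=g\big(x(\tau(g^{-1})t)\big)$. Let $\Lambda^G$ be the set of loops $x\in\Lambda$ with $gx=x$ for all $g\in G$. For a subgroup $H\le G$ let $\mathcal X^H$ be the set of configurations in $\mathcal X$ fixed by $H$, and for $t\in\mathbb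 T$ let $G_t=\{g\in G:\tau(g)t=t\}$. The action is of cyclic type if $\tau(G)\subset SO(2)$. A fundamental domain is an interval $\mathbb I=[t_0,t_1]$ with $t_0<t_1$ such that - in the cyclic case, $t_1=t_0+T/|G/\ker\tau|$; - otherwise, $G_{t_0}$ and $G_{t_1}$ are maximal among the isotropy groups $G_t$, $t\in\mathbb T$, and $G_s$ is not maximal for any $s\in(t_0,t_1)$. Let $Y$ be the space of all $y\in H^1(\mathbb I;\mathcal X^{\ker\tau})$ such that - in the cyclic case, $g\,y(t_0)=y(t_1)$, where $g\in G$ is any element such that $\tau(g)$ is the rotation by $2\pi/|G/\ker\tau|$ (the choice of $g$ does not matter); - otherwise, $y(t_0)\in\mathcal X^{G_{t_0}}$ and $y(t_1)\in\mathcal X^{G_{t_1}}$. For $y\in Y$ let $\mathcal A_{\mathbb I}(y)=\int_{\mathbb I}\big(\tfrac12\sum_i m_i\|\dot y_i\|^2+U(y)\big)\,dt\in[0,+\infty]$. **Theorem.** Let $y\in Y$ be collision-less, i.e. $y_i(t)\neq y_j(t)$ for all $t\in\mathbb I$ and $i\ne j$, and let $y$ be a critical point of $\mathcal A_{\mathbb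 I}$ on $Y$: $\frac{d}{d\varepsilon}\mathcal A_{\mathbb I}(y+\varepsilon\varphi)\big|_{\varepsilon=0}=0$ for all $\varphi\in Y$. Let $x$ be the symmetrised path, obtained by gluing the copies of $y$: $x(\tau(g)t)=g\,(y(t))$ for $g\in G$, $t\in\mathbb I$. Then $x$ is a well-defined loop in $\Lambda^G$, it is the only element of $\Lambda^G$ whose restriction to $\mathbb I$ is $y$ (so $x=\pi^{-1}y$ for the restriction map $\pi$), and it is a classical $T$-periodic solution of the $n$-body problem: $x$ is of class $C^2$ on $\mathbb R$, it has no collisions, and $$m_i\ddot x_i(t)=\frac{\partial U}{\partial x_i}(x(t))\qquad\text{for all } t\in\mathbb R,\ i=1,\dots,n.$$ -/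

import Mathlib

open MeasureTheory Set
open scoped ContDiff

noncomputable section

namespace NBody

/-! ### The Sobolev space `H¹` of an interval -/

section Sobolev

variable {E : Type*} [NormedAddCommGroup E] [NormedSpace ℝ E]

/-- `v` is a weak derivative of `y` on the open interval `(a, b)`, tested against smooth functions
with compact support in `(a, b)`. -/
def IsWeakDerivOn (a b : ℝ) (y v : ℝ → E) : Prop :=
  ∀ φ : ℝ → ℝ, ContDiff ℝ ∞ φ → HasCompactSupport φ → tsupport φ ⊆ Ioo a b →
    ∫ t in Ioo a b, deriv φ t • y t = -∫ t in Ioo a b, φ t • v t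

/-- `v` is a weak derivative of `y` on `(a, b)` and belongs to `L²(a, b)`. -/
def IsL2WeakDerivOn (a b : ℝ) (y v : ℝ → E) : Prop :=
  IsWeakDerivOn a b y v ∧ MemLp v 2 (volume.restrict (Ioo a b))

/-- `y` represents an element of `H¹([a, b]; E)`. As usual, an element of `H¹` is identified with
its continuous representative on `[a, b]` (which is then in `L²`); only the values of `y` on
`[a, b]` matter. -/
def MemH1 (a b : ℝ) (y : ℝ → E) : Prop :=
  ContinuousOn y (Icc a b) ∧ ∃ v, IsL2WeakDerivOn a b y v

open Classical in
/-- The weak derivative in `L²(a, b)` of a path in `H¹([a, b]; E)`; it is unique up to equality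
almost everywhere on `(a, b)`. (It is `0` by convention if there is none.) -/
def weakDeriv (a b : ℝ) (y : ℝ → E) : ℝ → E :=
  if h : ∃ v, IsL2WeakDerivOn a b y v then h.choose else 0

end Sobolev

/-! ### The `n`-body problem with symmetries -/

/-- `n`-tuples of positions in `ℝ^d`. -/
abbrev Config (n d : ℕ) : Type := Fin n → EuclideanSpace ℝ (Fin d)

/-- The data of the symmetric `n`-body problem: positive masses, a positive period `T`, and
homomorphisms `ρ : G → O(d)`, `τ : G → O(2)` and `σ : G → Σ_n` such that only bodies with equal
masses are interchanged. The Euclidean plane on which `O(2)` acts is taken to be `ℂ`. -/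
structure SymmetricSystem (G : Type*) [Group G] (n d : ℕ) where
  m : Fin n → ℝ
  m_pos : ∀ i, 0 < m i
  T : ℝ
  T_pos : 0 < T
  ρ : G →* (EuclideanSpace ℝ (Fin d) ≃ₗᵢ[ℝ] EuclideanSpace ℝ (Fin d))
  τ : G →* (ℂ ≃ₗᵢ[ℝ] ℂ)
  σ : G →* Equiv.Perm (Fin n)
  m_eq : ∀ (g : G) (i : Fin n), m (σ g⁻¹ i) = m i

namespace SymmetricSystem

variable {G : Type*} [Group G] {n d : ℕ} (S : SymmetricSystem G n d)

/-- The configuration space `𝒳`: centre of mass at the origin. -/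
def configSpace : Set (Config n d) := {x | ∑ i, S.m i • x i = 0}

/-- The configuration is outside the collision set `Δ`. -/
def CollisionFree (x : Config n d) : Prop := ∀ i j, i ≠ j → x i ≠ x j

/-- The Newtonian potential `U(x) = ∑_{i<j} m_i m_j / |x_i - x_j|`, meaningful off collisions. -/
def potential (x : Config n d) : ℝ :=
  ∑ i, ∑ j ∈ Finset.Ioi i, S.m i * S.m j / ‖x i - x j‖

open Classical in
/-- The potential as a function with values in `[0, +∞]`, infinite at collisions. -/
def extPotential (x : Config n d) : ENNReal :=
  if CollisionFree x then ENNReal.ofReal (S.potential x) else ⊤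

/-- The kinetic energy `K(v) = ½ ∑ m_i |v_i|²`. -/
def kinetic (v : Config n d) : ℝ := 2⁻¹ * ∑ i, S.m i * ‖v i‖ ^ 2

/-- The Lagrange action `∫_a^b (K(ẏ) + U(y)) dt ∈ [0, +∞]` of a path on `[a, b]`. -/
def action (a b : ℝ) (y : ℝ → Config n d) : ENNReal :=
  ∫⁻ t in Icc a b, (ENNReal.ofReal (S.kinetic (weakDeriv a b y t)) + S.extPotential (y t))

/-- The action of `G` on configurations, `(g x)_i = ρ(g) x_{σ(g⁻¹) i}`. -/
def act (g : G) (x : Config n d) : Config n d := fun i => S.ρ g (x (S.σ g⁻¹ i))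

/-- The space `𝒳^H` of configurations fixed by a subgroup `H`. -/
def fixedSpace (H : Subgroup G) : Set (Config n d) :=
  {x | x ∈ S.configSpace ∧ ∀ h ∈ H, S.act h x = x}

/-- The point of the unit circle which corresponds to the class of `t` in `𝕋 = ℝ/Tℤ`. -/
def timePoint (t : ℝ) : ℂ := Circle.exp (2 * Real.pi * t / S.T)

/-- `s = τ(g) t` as elements of the time circle `𝕋 = ℝ/Tℤ`. -/
def IsTimeImage (g : G) (t s : ℝ) : Prop := S.timePoint s = S.τ g (S.timePoint t)

/-- The `𝕋`-isotropy subgroup `G_t = {g | τ(g) t = t}`. -/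
def isotropy (t : ℝ) : Subgroup G where
  carrier := {g | S.τ g (S.timePoint t) = S.timePoint t}
  one_mem' := by simp
  mul_mem' := by
    intro g h hg hh
    change S.τ (g * h) (S.timePoint t) = S.timePoint t
    change S.τ g (S.timePoint t) = S.timePoint t at hg
    change S.τ h (S.timePoint t) = S.timePoint t at hh
    rw [map_mul]
    change S.τ g (S.τ h (S.timePoint t)) = S.timePoint t
    rw [hh, hg]
  inv_mem' := by
    intro g hg
    change S.τ g⁻¹ (S.timePoint t) = S.timePoint t
    change S.τ g (S.timePoint t) = S.timePoint t at hg
    rw [map_inv]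
    change (S.τ g).symm (S.timePoint t) = S.timePoint t
    rw [LinearIsometryEquiv.symm_apply_eq, hg]

/-- `G_t` is a maximal element of the set of all `𝕋`-isotropy subgroups. -/
def IsMaximalIsotropy (t : ℝ) : Prop := Maximal (· ∈ range S.isotropy) (S.isotropy t)

/-- The space `Λ = H¹(𝕋; 𝒳)` of loops, seen as `T`-periodic functions on `ℝ`. -/
def loopSpace : Set (ℝ → Config n d) :=
  {x | Function.Periodic x S.T ∧ MemH1 0 S.T x ∧ ∀ t, x t ∈ S.configSpace}

/-- The space `Λ^G` of equivariant loops: `(g x)(t) = x(t)` for all `g` and `t`, where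
`(g x)_i(t) = ρ(g) x_{σ(g⁻¹) i}(τ(g⁻¹) t)`. -/
def equivariantLoops : Set (ℝ → Config n d) :=
  {x | x ∈ S.loopSpace ∧ ∀ (g : G) (t s : ℝ), S.IsTimeImage g⁻¹ t s → S.act g (x s) = x t}

/-- The action is of cyclic type: every `τ(g)` is a rotation. Otherwise it is of brake type (if
`τ(G)` consists of the identity and one reflection) or of dihedral type. -/
def IsCyclicType : Prop := ∀ g, S.τ g ∈ (rotation : Circle →* (ℂ ≃ₗᵢ[ℝ] ℂ)).range

/-- `[t₀, t₁]` is a fundamental domain of the action of `G` on `𝕋`.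

Cyclic type: an interval of length `T / |G / ker τ|`, so that it joins an instant to its image under
the rotation by the smallest positive angle in `τ(G)`. (One may, but need not, take an endpoint
at `0`.)

Brake or dihedral type: the endpoints are consecutive among the instants whose isotropy subgroup is
maximal. (Two such endpoints are always distinct in `𝕋`, and their isotropy subgroups are distinct
unless the action is of brake type.) -/
def IsFundamentalDomain (t₀ t₁ : ℝ) : Prop :=
  (S.IsCyclicType → t₁ = t₀ + S.T / Nat.card (G ⧸ S.τ.ker)) ∧
  (¬ S.IsCyclicType → t₀ < t₁ ∧ S.IsMaximalIsotropy t₀ ∧ S.IsMaximalIsotropy t₁ ∧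
    ∀ s ∈ Ioo t₀ t₁, ¬ S.IsMaximalIsotropy s)

/-- The linear space `Y` of the paths in `H¹([t₀, t₁]; 𝒳^{ker τ})` which satisfy the boundary
conditions imposed by the symmetry: `g y(t₀) = y(t₁)` in the cyclic case, where `τ(g)` is the
generator of `τ(G)` that maps `t₀` to `t₁` (`g` is unique modulo `ker τ`, which acts trivially on
`𝒳^{ker τ}`), and `y(t₀) ∈ 𝒳^{H₀}`, `y(t₁) ∈ 𝒳^{H₁}` with the isotropy subgroups `H₀`, `H₁` of the
endpoints in the other cases. -/
def pathSpace (t₀ t₁ : ℝ) : Set (ℝ → Config n d) :=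
  {y | MemH1 t₀ t₁ y ∧ (∀ t ∈ Icc t₀ t₁, y t ∈ S.fixedSpace S.τ.ker) ∧
    (S.IsCyclicType → ∀ g, S.IsTimeImage g t₀ t₁ → S.act g (y t₀) = y t₁) ∧
    (¬ S.IsCyclicType →
      y t₀ ∈ S.fixedSpace (S.isotropy t₀) ∧ y t₁ ∈ S.fixedSpace (S.isotropy t₁))}

/-- `y` is a critical point in `Y` of the action restricted to `[t₀, t₁]`: the directional
derivatives of the action at `y` in all directions of the linear space `Y` exist and vanish. (The
action is finite near a collision-free path of `Y`.) -/
def IsCriticalPoint (t₀ t₁ : ℝ) (y : ℝ → Config n d) : Prop :=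
  y ∈ S.pathSpace t₀ t₁ ∧ ∀ φ ∈ S.pathSpace t₀ t₁,
    HasDerivAt (fun ε : ℝ => (S.action t₀ t₁ (y + ε • φ)).toReal) 0 0

open Classical in
/-- The symmetrised path: the concatenation of the copies `g y` of `y`. At an instant `s = τ(g) t`
with `t ∈ [t₀, t₁]` its value is `g (y(t))`. -/
def symmetrised (t₀ t₁ : ℝ) (y : ℝ → Config n d) : ℝ → Config n d := fun s =>
  if h : ∃ p : G × ℝ, p.2 ∈ Icc t₀ t₁ ∧ S.IsTimeImage p.1 p.2 s then
    S.act h.choose.1 (y h.choose.2)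
  else 0

/-- `x` is a classical (collision-free, twice continuously differentiable, defined for all times)
solution of Newton's equations `m_i x_i'' = ∂U/∂x_i`. -/
def IsClassicalSolution (x : ℝ → Config n d) : Prop :=
  ContDiff ℝ 2 x ∧ (∀ t, CollisionFree (x t)) ∧
    ∀ t i, S.m i • deriv (deriv fun s => x s i) t =
      gradient (fun z => S.potential (Function.update (x t) i z)) (x t i)

end SymmetricSystem

end NBody

end

/-! The argument has three ingredients. Equation and regularity. Varying `y` by `η • w`, with `η` a
test function and `w` fixed by `ker τ`, gives the Euler-Lagrange equation weakly, but only when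
paired with such `w`. Nothing is lost. The Newtonian acceleration commutes with `G` and has zero
total momentum (`accel_act`, `accel_mem_configSpace`), so along `y` it lies in the same subspace, on
which the mass inner product is definite. Hence `y` minus a double primitive of the acceleration is
affine by du Bois-Reymond, and `y` is C² up to the endpoints (`IsCriticalPoint.exists_hasDerivAt`).
Natural boundary conditions. Variations that do not vanish at the endpoints leave only boundary
terms (`IsCriticalPoint.massForm_boundary`). Since `G` acts by isometries of the mass inner product,
these terms say that a shift joining the endpoints carries one end velocity to the other, and that a
reflection fixing an endpoint reverses the velocity there (`ShiftsTime.act_velocity`,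
`FlipsTime.act_velocity`). Gluing. Copies of the fundamental domain cover the time line, and
identifications inside it occur only through `ker τ` or at the endpoints, where the conditions
defining `Y` apply (`IsFundamentalDomain.exists_isTimeImage`, `IsFundamentalDomain.act_eq`). So `x`
is well defined. Its one-sided velocities agree at the junctions by the boundary conditions, and its
one-sided accelerations agree because they are an equivariant function of position. Newton's
equation then spreads from the fundamental domain to all times by equivariance. -/

namespace NBody

/-! ### Test functions and the lemma of du Bois-Reymond -/

/-- Smooth real functions with compact support in the open interval `(a, b)`. -/
structure IsTestFun (a b : ℝ) (η : ℝ → ℝ) : Prop where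
  contDiff : ContDiff ℝ ∞ η
  hasCompactSupport : HasCompactSupport η
  tsupport_subset : tsupport η ⊆ Ioo a b

theorem IsTestFun.continuous {a b : ℝ} {η : ℝ → ℝ} (h : IsTestFun a b η) : Continuous η :=
  h.contDiff.continuous

theorem IsTestFun.eq_zero {a b : ℝ} {η : ℝ → ℝ} (h : IsTestFun a b η) {t : ℝ}
    (ht : t ∉ Ioo a b) : η t = 0 :=
  image_eq_zero_of_notMem_tsupport fun h' => ht (h.tsupport_subset h')

theorem IsTestFun.deriv {a b : ℝ} {η : ℝ → ℝ} (h : IsTestFun a b η) :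
    IsTestFun a b (deriv η) where
  contDiff := (contDiff_infty_iff_deriv.1 h.contDiff).2
  hasCompactSupport := h.hasCompactSupport.deriv
  tsupport_subset := (closure_minimal support_deriv_subset (isClosed_tsupport η)).trans
    h.tsupport_subset

theorem IsTestFun.sub_const_mul {a b : ℝ} {η ζ : ℝ → ℝ} (h : IsTestFun a b η)
    (h' : IsTestFun a b ζ) (c : ℝ) : IsTestFun a b (fun t => η t - c * ζ t) := by
  have hsub : tsupport (fun t => η t - c * ζ t) ⊆ tsupport η ∪ tsupport ζ := by
    refine closure_minimal (fun t ht => ?_) ((isClosed_tsupport η).union (isClosed_tsupport ζ))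
    by_contra hn
    rw [mem_union, not_or] at hn
    exact ht (by simp [image_eq_zero_of_notMem_tsupport hn.1,
      image_eq_zero_of_notMem_tsupport hn.2])
  refine ⟨h.contDiff.sub (contDiff_const.mul h'.contDiff), ?_,
    hsub.trans (union_subset h.tsupport_subset h'.tsupport_subset)⟩
  exact (h.hasCompactSupport.isCompact.union h'.hasCompactSupport.isCompact).of_isClosed_subset
    (isClosed_tsupport _) hsub

theorem setIntegral_Ioo_eq_intervalIntegral {E : Type*} [NormedAddCommGroup E] [NormedSpace ℝ E]
    {a b : ℝ} (hab : a ≤ b) (f : ℝ → E) : ∫ t in Ioo a b, f t = ∫ t in a..b, f t := by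
  rw [intervalIntegral.integral_of_le hab, integral_Ioc_eq_integral_Ioo]

/-- A test function of mean zero is the derivative of a test function. -/
theorem IsTestFun.exists_deriv_eq {a b : ℝ} (hab : a < b) {η : ℝ → ℝ} (h : IsTestFun a b η)
    (h0 : ∫ t in Ioo a b, η t = 0) : ∃ θ, IsTestFun a b θ ∧ _root_.deriv θ = η := by
  obtain ⟨c, e, hc, he, hK⟩ : ∃ c e, a < c ∧ e < b ∧ tsupport η ⊆ Icc c e := by
    rcases (tsupport η).eq_empty_or_nonempty with hE | hne
    -- For empty support the reversed, hence empty, interval meets all the requirements.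
    · exact ⟨b, a, hab, hab, by simp [hE]⟩
    · obtain ⟨c, hc⟩ := h.hasCompactSupport.isCompact.exists_isLeast hne
      obtain ⟨e, he⟩ := h.hasCompactSupport.isCompact.exists_isGreatest hne
      exact ⟨c, e, (h.tsupport_subset hc.1).1, (h.tsupport_subset he.1).2,
        fun t ht => ⟨hc.2 ht, he.2 ht⟩⟩
  have hz : ∀ t, t ∉ Icc c e → η t = 0 := fun t ht =>
    image_eq_zero_of_notMem_tsupport fun h' => ht (hK h')
  have hd : ∀ t, HasDerivAt (fun t => ∫ s in a..t, η s) (η t) t := fun t =>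
    (h.continuous.integral_hasStrictDerivAt a t).hasDerivAt
  have hd' : _root_.deriv (fun t => ∫ s in a..t, η s) = η := funext fun t => (hd t).deriv
  have hleft : ∀ t, t < c → ∫ s in a..t, η s = 0 := fun t ht => by
    rw [intervalIntegral.integral_congr (g := fun _ => 0)]
    · simp
    · intro s hs
      refine hz s fun hs' => ?_
      have := hs.2
      exact absurd (hs'.1.trans this) (not_le.2 (max_lt hc ht))
  -- This is where the mean-zero hypothesis enters: it makes the primitive return to zero to the
  -- right of the support.
  have hright : ∀ t, e < t → ∫ s in a..t, η s = 0 := fun t ht => by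
    rw [← intervalIntegral.integral_add_adjacent_intervals (b := b)
      (h.continuous.intervalIntegrable _ _) (h.continuous.intervalIntegrable _ _),
      ← setIntegral_Ioo_eq_intervalIntegral hab.le, h0, zero_add,
      intervalIntegral.integral_congr (g := fun _ => 0)]
    · simp
    · intro s hs
      refine hz s fun hs' => ?_
      exact absurd (hs.1.trans hs'.2) (not_le.2 (lt_min he ht))
  have hsub : tsupport (fun t => ∫ s in a..t, η s) ⊆ Icc c e := by
    refine closure_minimal (fun t ht => ?_) isClosed_Icc
    by_contra hn
    rw [mem_Icc, not_and_or, not_le, not_le] at hn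
    exact ht (hn.elim (hleft t) (hright t))
  refine ⟨_, ⟨?_, isCompact_Icc.of_isClosed_subset (isClosed_tsupport _) hsub,
    fun t ht => ⟨hc.trans_le (hsub ht).1, (hsub ht).2.trans_lt he⟩⟩, hd'⟩
  rw [contDiff_infty_iff_deriv, hd']
  exact ⟨fun t => (hd t).differentiableAt, h.contDiff⟩

theorem exists_isTestFun_integral_eq_one {a b : ℝ} (hab : a < b) :
    ∃ η, IsTestFun a b η ∧ ∫ t in Ioo a b, η t = 1 := by
  have hr : 0 < (b - a) / 4 := by linarith
  let f : ContDiffBump ((a + b) / 2) := ⟨(b - a) / 8, (b - a) / 4, by linarith, by linarith⟩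
  have hs : tsupport (f.normed volume) ⊆ Ioo a b := by
    rw [f.tsupport_normed_eq, Real.closedBall_eq_Icc]
    intro t ht
    change t ∈ Icc ((a + b) / 2 - (b - a) / 4) ((a + b) / 2 + (b - a) / 4) at ht
    constructor <;> linarith [ht.1, ht.2]
  refine ⟨f.normed volume, ⟨f.contDiff_normed, f.hasCompactSupport_normed, hs⟩, ?_⟩
  rw [setIntegral_eq_integral_of_forall_compl_eq_zero, f.integral_normed]
  exact fun t ht => image_eq_zero_of_notMem_tsupport fun h' => ht (hs h')

theorem IsTestFun.integrable_smul {E : Type*} [NormedAddCommGroup E] [NormedSpace ℝ E]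
    {a b : ℝ} {η : ℝ → ℝ} (h : IsTestFun a b η) {q : ℝ → E}
    (hq : Integrable q (volume.restrict (Ioo a b))) :
    Integrable (fun t => η t • q t) (volume.restrict (Ioo a b)) := by
  obtain ⟨C, hC⟩ := h.hasCompactSupport.exists_bound_of_continuous h.continuous
  exact hq.bdd_smul C h.continuous.aestronglyMeasurable (Filter.Eventually.of_forall hC)

theorem integrable_Ioo_of_continuousOn {E : Type*} [NormedAddCommGroup E]
    {a b : ℝ} {q : ℝ → E} (hq : ContinuousOn q (Icc a b)) :
    Integrable q (volume.restrict (Ioo a b)) :=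
  (hq.integrableOn_compact isCompact_Icc).mono_set Ioo_subset_Icc_self

/-- The lemma of du Bois-Reymond. -/
theorem exists_eqOn_const_of_integral_deriv_mul_eq_zero {a b : ℝ} (hab : a < b) {q : ℝ → ℝ}
    (hq : ContinuousOn q (Icc a b))
    (h : ∀ η, IsTestFun a b η → ∫ t in Ioo a b, deriv η t * q t = 0) :
    ∃ c, EqOn q (fun _ => c) (Icc a b) := by
  obtain ⟨η₀, h₀, h₁⟩ := exists_isTestFun_integral_eq_one hab
  have hqi := integrable_Ioo_of_continuousOn hq
  set c := ∫ t in Ioo a b, η₀ t * q t with hc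
  refine ⟨c, ?_⟩
  have hfi : Integrable (fun t => q t - c) (volume.restrict (Ioo a b)) :=
    hqi.sub (integrable_const _)
  have hae : ∀ᵐ t, t ∈ Ioo a b → q t - c = 0 := by
    refine isOpen_Ioo.ae_eq_zero_of_integral_contDiff_smul_eq_zero
      (IntegrableOn.locallyIntegrableOn hfi) fun η hη1 hη2 hη3 => ?_
    have hη : IsTestFun a b η := ⟨hη1, hη2, hη3⟩
    have hone : Integrable (fun _ : ℝ => (1 : ℝ)) (volume.restrict (Ioo a b)) := integrable_const _
    have hηi : Integrable η (volume.restrict (Ioo a b)) := by simpa using hη.integrable_smul hone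
    have h₀i : Integrable η₀ (volume.restrict (Ioo a b)) := by simpa using h₀.integrable_smul hone
    set k := ∫ t in Ioo a b, η t with hk
    -- Subtracting `k` copies of the unit-mass function `η₀` removes the mean of `η`, so the
    -- hypothesis applies to the resulting primitive `θ`.
    obtain ⟨θ, hθ, hθ'⟩ := (hη.sub_const_mul h₀ k).exists_deriv_eq hab (by
      rw [integral_sub hηi (h₀i.const_mul k), integral_const_mul, h₁, ← hk]; ring)
    have h2 := h θ hθ
    rw [hθ'] at h2
    have hi1 : Integrable (fun t => η t * q t) (volume.restrict (Ioo a b)) :=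
      hη.integrable_smul hqi
    have hi2 : Integrable (fun t => η₀ t * q t) (volume.restrict (Ioo a b)) :=
      h₀.integrable_smul hqi
    have h3 : ∫ t in Ioo a b, η t * q t = k * c := by
      have : ∫ t in Ioo a b, (η t - k * η₀ t) * q t
          = (∫ t in Ioo a b, η t * q t) - k * c := by
        rw [hc, ← integral_const_mul, ← integral_sub hi1 (hi2.const_mul k)]
        congr 1; ext t; ring
      linarith
    rw [setIntegral_eq_integral_of_forall_compl_eq_zero (s := Ioo a b)
      (f := fun t => η t * q t)] at h3
    · rw [← setIntegral_eq_integral_of_forall_compl_eq_zero (s := Ioo a b)]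
      · calc ∫ t in Ioo a b, η t • (q t - c)
            = ∫ t in Ioo a b, (η t * q t - c * η t) := by
              congr 1; ext t; simp only [smul_eq_mul]; ring
          _ = 0 := by
              rw [integral_sub hi1 (hηi.const_mul c), integral_const_mul, ← hk]
              rw [setIntegral_eq_integral_of_forall_compl_eq_zero (f := fun t => η t * q t), h3]
              · ring
              · intro t ht; simp [hη.eq_zero ht]
      · intro t ht; simp [hη.eq_zero ht]
    · intro t ht; simp [hη.eq_zero ht]
  have hae' : q =ᵐ[volume.restrict (Ioo a b)] fun _ => c :=
    (ae_restrict_iff' measurableSet_Ioo).2 (hae.mono fun t ht h' => sub_eq_zero.1 (ht h'))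
  have hIoo : EqOn q (fun _ => c) (Ioo a b) :=
    Measure.eqOn_open_of_ae_eq hae' isOpen_Ioo (hq.mono Ioo_subset_Icc_self) continuousOn_const
  exact hIoo.of_subset_closure hq continuousOn_const Ioo_subset_Icc_self
    (closure_Ioo hab.ne).ge

theorem IsTestFun.integral_deriv_smul {E : Type*} [NormedAddCommGroup E] [NormedSpace ℝ E]
    [CompleteSpace E] {a b : ℝ} (hab : a ≤ b) {η : ℝ → ℝ} (h : IsTestFun a b η) {q q' : ℝ → E}
    (hq : ∀ t, HasDerivAt q (q' t) t) (hq' : Continuous q') :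
    ∫ t in Ioo a b, _root_.deriv η t • q t = -∫ t in Ioo a b, η t • q' t := by
  rw [setIntegral_Ioo_eq_intervalIntegral hab, setIntegral_Ioo_eq_intervalIntegral hab,
    eq_neg_iff_add_eq_zero, ← intervalIntegral.integral_add]
  · rw [intervalIntegral.integral_eq_sub_of_hasDerivAt (f := fun t => η t • q t)]
    · simp [h.eq_zero (t := a) (by simp), h.eq_zero (t := b) (by simp)]
    · intro t _
      have := ((h.contDiff.differentiable (by simp) t).hasDerivAt).smul (hq t)
      rwa [add_comm] at this
    · have hqc : Continuous q := continuous_iff_continuousAt.2 fun t => (hq t).continuousAt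
      exact ((h.deriv.continuous.smul hqc).add (h.continuous.smul hq')).intervalIntegrable _ _
  · have hqc : Continuous q := continuous_iff_continuousAt.2 fun t => (hq t).continuousAt
    exact (h.deriv.continuous.smul hqc).intervalIntegrable _ _
  · exact (h.continuous.smul hq').intervalIntegrable _ _

/-- A continuous function whose second derivative vanishes weakly is affine. -/
theorem exists_eqOn_affine_of_integral_deriv_deriv_mul_eq_zero {a b : ℝ} (hab : a < b)
    {q : ℝ → ℝ} (hq : ContinuousOn q (Icc a b))
    (h : ∀ η, IsTestFun a b η → ∫ t in Ioo a b, deriv (deriv η) t * q t = 0) :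
    ∃ c k, EqOn q (fun t => c + k * t) (Icc a b) := by
  obtain ⟨η₀, h₀, h₁⟩ := exists_isTestFun_integral_eq_one hab
  have hqi := integrable_Ioo_of_continuousOn hq
  set k := ∫ t in Ioo a b, deriv η₀ t * q t with hk
  have hq2 : ContinuousOn (fun t => q t + k * t) (Icc a b) := by fun_prop
  have hidi : Integrable (fun t : ℝ => t) (volume.restrict (Ioo a b)) :=
    integrable_Ioo_of_continuousOn continuousOn_id
  -- The pairing of `deriv η` with `q` is `k` times the integral of `η`, and its pairing with `t` is
  -- minus that integral. Adding `k * t` to `q` cancels the two, so the slope of `q` is `-k`.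
  obtain ⟨c, hc⟩ := exists_eqOn_const_of_integral_deriv_mul_eq_zero hab hq2 fun η hη => by
    have hone : Integrable (fun _ : ℝ => (1 : ℝ)) (volume.restrict (Ioo a b)) := integrable_const _
    have hηi : Integrable η (volume.restrict (Ioo a b)) := by simpa using hη.integrable_smul hone
    have h₀i : Integrable η₀ (volume.restrict (Ioo a b)) := by simpa using h₀.integrable_smul hone
    set l := ∫ t in Ioo a b, η t with hl
    obtain ⟨θ, hθ, hθ'⟩ := (hη.sub_const_mul h₀ l).exists_deriv_eq hab (by
      rw [integral_sub hηi (h₀i.const_mul l), integral_const_mul, h₁, ← hl]; ring)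
    have h2 := h θ hθ
    have hdd : deriv (fun t => η t - l * η₀ t) = fun t => deriv η t - l * deriv η₀ t := by
      ext t
      have e1 := (hη.contDiff.differentiable (by simp) t).hasDerivAt
      have e2 := (h₀.contDiff.differentiable (by simp) t).hasDerivAt
      exact (e1.sub (e2.const_mul l)).deriv
    rw [hθ', hdd] at h2
    have hi1 : Integrable (fun t => deriv η t * q t) (volume.restrict (Ioo a b)) :=
      hη.deriv.integrable_smul hqi
    have hi2 : Integrable (fun t => deriv η₀ t * q t) (volume.restrict (Ioo a b)) :=
      h₀.deriv.integrable_smul hqi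
    have hi3 : Integrable (fun t => deriv η t * t) (volume.restrict (Ioo a b)) :=
      hη.deriv.integrable_smul hidi
    have h3 : ∫ t in Ioo a b, deriv η t * q t = l * k := by
      have : ∫ t in Ioo a b, (deriv η t - l * deriv η₀ t) * q t
          = (∫ t in Ioo a b, deriv η t * q t) - l * k := by
        rw [hk, ← integral_const_mul, ← integral_sub hi1 (hi2.const_mul l)]
        congr 1; ext t; ring
      linarith
    have h4 : ∫ t in Ioo a b, deriv η t * t = -l := by
      have := hη.integral_deriv_smul hab.le (q := fun t => t) (q' := fun _ => (1 : ℝ))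
        (fun t => hasDerivAt_id t) continuous_const
      simpa [smul_eq_mul, ← hl] using this
    calc ∫ t in Ioo a b, deriv η t * (q t + k * t)
        = ∫ t in Ioo a b, (deriv η t * q t + k * (deriv η t * t)) := by
          congr 1; ext t; ring
      _ = 0 := by
          rw [integral_add hi1 (hi3.const_mul k), integral_const_mul, h3, h4]; ring
  exact ⟨c, -k, fun t ht => by have := hc ht; simp only at this ⊢; linarith⟩

/-! ### Square-integrable weak derivatives -/

theorem IsL2WeakDerivOn.integrable {E : Type*} [NormedAddCommGroup E] [NormedSpace ℝ E]
    {a b : ℝ} {y v : ℝ → E} (h : IsL2WeakDerivOn a b y v) :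
    Integrable v (volume.restrict (Ioo a b)) :=
  h.2.integrable (by norm_num)

theorem IsL2WeakDerivOn.ae_eq {E : Type*} [NormedAddCommGroup E] [NormedSpace ℝ E]
    [FiniteDimensional ℝ E]
    {a b : ℝ} {y v w : ℝ → E} (hv : IsL2WeakDerivOn a b y v) (hw : IsL2WeakDerivOn a b y w) :
    v =ᵐ[volume.restrict (Ioo a b)] w := by
  have := FiniteDimensional.complete ℝ E
  have hae : ∀ᵐ t, t ∈ Ioo a b → v t - w t = 0 := by
    refine isOpen_Ioo.ae_eq_zero_of_integral_contDiff_smul_eq_zero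
      (IntegrableOn.locallyIntegrableOn (hv.integrable.sub hw.integrable)) fun η h1 h2 h3 => ?_
    have hη : IsTestFun a b η := ⟨h1, h2, h3⟩
    rw [← setIntegral_eq_integral_of_forall_compl_eq_zero (s := Ioo a b)]
    · simp only [smul_sub]
      rw [integral_sub (hη.integrable_smul hv.integrable) (hη.integrable_smul hw.integrable),
        sub_eq_zero, ← neg_inj, ← hv.1 η h1 h2 h3, hw.1 η h1 h2 h3]
    · intro t ht; simp [hη.eq_zero ht]
  exact (ae_restrict_iff' measurableSet_Ioo).2 (hae.mono fun t ht h' => sub_eq_zero.1 (ht h'))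

/-- The action is defined with an arbitrarily chosen weak derivative; this lets any convenient
representative replace it under the integral. -/
theorem weakDeriv_ae_eq {E : Type*} [NormedAddCommGroup E] [NormedSpace ℝ E]
    [FiniteDimensional ℝ E] {a b : ℝ} {y v : ℝ → E} (hv : IsL2WeakDerivOn a b y v) :
    weakDeriv a b y =ᵐ[volume.restrict (Ioo a b)] v := by
  have h : ∃ v, IsL2WeakDerivOn a b y v := ⟨v, hv⟩
  rw [weakDeriv, dif_pos h]
  exact h.choose_spec.ae_eq hv

theorem isL2WeakDerivOn_of_hasDerivAt {E : Type*} [NormedAddCommGroup E] [NormedSpace ℝ E]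
    [CompleteSpace E] {a b : ℝ} (hab : a ≤ b) {q q' : ℝ → E}
    (hq : ∀ t, HasDerivAt q (q' t) t) (hq' : Continuous q') : IsL2WeakDerivOn a b q q' := by
  refine ⟨fun η h1 h2 h3 => IsTestFun.integral_deriv_smul hab ⟨h1, h2, h3⟩ hq hq', ?_⟩
  obtain ⟨C, hC⟩ := isCompact_Icc.exists_bound_of_continuousOn (hq'.continuousOn (s := Icc a b))
  exact MemLp.of_bound hq'.aestronglyMeasurable C
    ((ae_restrict_iff' measurableSet_Ioo).2
      (Filter.Eventually.of_forall fun t ht => hC t (Ioo_subset_Icc_self ht)))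

theorem memH1_of_hasDerivAt {E : Type*} [NormedAddCommGroup E] [NormedSpace ℝ E]
    [CompleteSpace E] {a b : ℝ} (hab : a ≤ b) {q q' : ℝ → E}
    (hq : ∀ t, HasDerivAt q (q' t) t) (hq' : Continuous q') : MemH1 a b q :=
  ⟨(continuous_iff_continuousAt.2 fun t => (hq t).continuousAt).continuousOn, q',
    isL2WeakDerivOn_of_hasDerivAt hab hq hq'⟩

theorem IsL2WeakDerivOn.add_const_smul {E : Type*} [NormedAddCommGroup E] [NormedSpace ℝ E]
    {a b : ℝ} {y v z w : ℝ → E} (hy : ContinuousOn y (Icc a b)) (hz : ContinuousOn z (Icc a b))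
    (hv : IsL2WeakDerivOn a b y v) (hw : IsL2WeakDerivOn a b z w) (ε : ℝ) :
    IsL2WeakDerivOn a b (y + ε • z) (v + ε • w) := by
  refine ⟨fun η h1 h2 h3 => ?_, hv.2.add (hw.2.const_smul ε)⟩
  have hη : IsTestFun a b η := ⟨h1, h2, h3⟩
  have i1 := hη.deriv.integrable_smul (integrable_Ioo_of_continuousOn hy)
  have i2 : Integrable (fun t => ε • deriv η t • z t) (volume.restrict (Ioo a b)) :=
    (hη.deriv.integrable_smul (integrable_Ioo_of_continuousOn hz)).smul ε
  have i3 := hη.integrable_smul hv.integrable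
  have i4 : Integrable (fun t => ε • η t • w t) (volume.restrict (Ioo a b)) :=
    (hη.integrable_smul hw.integrable).smul ε
  simp only [Pi.add_apply, Pi.smul_apply, smul_add, smul_comm _ ε]
  rw [integral_add i1 i2, integral_add i3 i4, integral_smul, integral_smul, hv.1 η h1 h2 h3,
    hw.1 η h1 h2 h3, smul_neg, neg_add]

end NBody

/-! ### The mass inner product, the group action and the Newtonian force -/

namespace NBody
namespace SymmetricSystem

variable {G : Type*} [Group G] {n d : ℕ} (S : SymmetricSystem G n d)

/-- The inner product on configurations weighted by the masses. -/
noncomputable def massForm : Config n d →L[ℝ] Config n d →L[ℝ] ℝ :=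
  ∑ i, S.m i • (innerSL ℝ).bilinearComp (ContinuousLinearMap.proj i) (ContinuousLinearMap.proj i)

theorem massForm_apply (u w : Config n d) :
    S.massForm u w = ∑ i, S.m i * inner ℝ (u i) (w i) := by
  simp [massForm]

theorem massForm_comm (u w : Config n d) : S.massForm u w = S.massForm w u := by
  simp only [massForm_apply, real_inner_comm]

theorem massForm_self_eq_zero {u : Config n d} (h : S.massForm u u = 0) : u = 0 := by
  rw [massForm_apply, Finset.sum_eq_zero_iff_of_nonneg
    (fun i _ => mul_nonneg (S.m_pos i).le real_inner_self_nonneg)] at h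
  ext1 i
  simpa [(S.m_pos i).ne'] using h i (Finset.mem_univ i)

theorem kinetic_eq (v : Config n d) : S.kinetic v = 2⁻¹ * S.massForm v v := by
  simp [kinetic, massForm_apply]

theorem kinetic_nonneg (v : Config n d) : 0 ≤ S.kinetic v :=
  mul_nonneg (by norm_num) (Finset.sum_nonneg fun i _ => mul_nonneg (S.m_pos i).le (sq_nonneg _))

/-- The action of a group element as a continuous linear map. -/
noncomputable def actCLM (g : G) : Config n d →L[ℝ] Config n d :=
  ContinuousLinearMap.pi fun i =>
    (S.ρ g : EuclideanSpace ℝ (Fin d) →L[ℝ] EuclideanSpace ℝ (Fin d)).comp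
      (ContinuousLinearMap.proj (S.σ g⁻¹ i))

@[simp] theorem actCLM_apply (g : G) (x : Config n d) : S.actCLM g x = S.act g x := rfl

theorem act_one (x : Config n d) : S.act 1 x = x := by
  ext1 i; simp [act]

theorem act_mul (g h : G) (x : Config n d) : S.act (g * h) x = S.act g (S.act h x) := by
  ext1 i; simp [act]

theorem act_inv_act (g : G) (x : Config n d) : S.act g⁻¹ (S.act g x) = x := by
  rw [← act_mul, inv_mul_cancel, act_one]

theorem act_act_inv (g : G) (x : Config n d) : S.act g (S.act g⁻¹ x) = x := by
  rw [← act_mul, mul_inv_cancel, act_one]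

theorem act_add (g : G) (x y : Config n d) : S.act g (x + y) = S.act g x + S.act g y :=
  (S.actCLM g).map_add x y

theorem act_neg (g : G) (x : Config n d) : S.act g (-x) = -S.act g x :=
  (S.actCLM g).map_neg x

theorem act_smul (g : G) (c : ℝ) (x : Config n d) : S.act g (c • x) = c • S.act g x :=
  (S.actCLM g).map_smul c x

theorem act_zero (g : G) : S.act g (0 : Config n d) = 0 := (S.actCLM g).map_zero

/-- `ρ g` is orthogonal and `σ g` permutes only bodies of equal mass, so reindexing the sum
suffices. -/
theorem massForm_act (g : G) (u w : Config n d) :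
    S.massForm (S.act g u) (S.act g w) = S.massForm u w := by
  rw [massForm_apply, massForm_apply,
    ← Equiv.sum_comp (S.σ g⁻¹) (fun i => S.m i * inner ℝ (u i) (w i))]
  exact Finset.sum_congr rfl fun i _ => by simp only [act, LinearIsometryEquiv.inner_map_map, S.m_eq]

theorem collisionFree_act (g : G) {x : Config n d} (h : CollisionFree x) :
    CollisionFree (S.act g x) := fun _ _ hij he =>
  h _ _ (fun h' => hij ((S.σ g⁻¹).injective h')) ((S.ρ g).injective he)

theorem act_mem_configSpace (g : G) {x : Config n d} (h : x ∈ S.configSpace) :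
    S.act g x ∈ S.configSpace := by
  change ∑ i, S.m i • S.ρ g (x (S.σ g⁻¹ i)) = 0
  have h' : ∑ i, S.m i • x i = 0 := h
  rw [← Equiv.sum_comp (S.σ g⁻¹)] at h'
  simp_rw [S.m_eq g] at h'
  have := congrArg (S.ρ g) h'
  simpa using this

/-- The configurations fixed by a subgroup, as a linear subspace. -/
def fixedSubmodule (H : Subgroup G) : Submodule ℝ (Config n d) where
  carrier := S.fixedSpace H
  zero_mem' := ⟨by simp [configSpace], fun h _ => S.act_zero h⟩
  add_mem' := by
    rintro x y ⟨hx, hx'⟩ ⟨hy, hy'⟩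
    refine ⟨?_, fun h hh => by rw [act_add, hx' h hh, hy' h hh]⟩
    have hx1 : ∑ i, S.m i • x i = 0 := hx
    have hy1 : ∑ i, S.m i • y i = 0 := hy
    simp [configSpace, smul_add, Finset.sum_add_distrib, hx1, hy1]
  smul_mem' := by
    rintro c x ⟨hx, hx'⟩
    refine ⟨?_, fun h hh => by rw [act_smul, hx' h hh]⟩
    have hx1 : ∑ i, S.m i • x i = 0 := hx
    simp [configSpace, smul_comm _ c, ← Finset.smul_sum, hx1]

/-- By normality, `h` applied after `g` is `g` applied after the element `g⁻¹ * h * g` of `H`. -/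
theorem act_mem_fixedSpace {H : Subgroup G} [hH : H.Normal] (g : G) {x : Config n d}
    (hx : x ∈ S.fixedSpace H) : S.act g x ∈ S.fixedSpace H := by
  refine ⟨S.act_mem_configSpace g hx.1, fun h hh => ?_⟩
  have := hx.2 _ (hH.conj_mem h hh g⁻¹)
  rw [inv_inv, act_mul, act_mul] at this
  rw [← S.act_act_inv g (S.act h (S.act g x)), this]

/-- The accelerations of the bodies given by Newton's law. -/
noncomputable def accel (x : Config n d) : Config n d := fun i =>
  ∑ j, (S.m j / ‖x i - x j‖ ^ 3) • (x j - x i)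

theorem accel_act (g : G) (x : Config n d) : S.accel (S.act g x) = S.act g (S.accel x) := by
  ext1 i
  change ∑ j, (S.m j / ‖S.ρ g (x (S.σ g⁻¹ i)) - S.ρ g (x (S.σ g⁻¹ j))‖ ^ 3) •
    (S.ρ g (x (S.σ g⁻¹ j)) - S.ρ g (x (S.σ g⁻¹ i))) =
    S.ρ g (∑ j, (S.m j / ‖x (S.σ g⁻¹ i) - x j‖ ^ 3) • (x j - x (S.σ g⁻¹ i)))
  rw [← Equiv.sum_comp (S.σ g⁻¹) (fun j => (S.m j / ‖x (S.σ g⁻¹ i) - x j‖ ^ 3) •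
    (x j - x (S.σ g⁻¹ i)))]
  simp [← map_sub, S.m_eq g, -map_inv, -map_sum]
  simp [map_sum]

/-- Action equals reaction: exchanging the two indices turns the double sum into its negative. -/
theorem accel_mem_configSpace (x : Config n d) : S.accel x ∈ S.configSpace := by
  change ∑ i, S.m i • ∑ j, (S.m j / ‖x i - x j‖ ^ 3) • (x j - x i) = 0
  simp_rw [Finset.smul_sum]
  have hself : ∀ v : EuclideanSpace ℝ (Fin d), v = -v → v = 0 := fun v hv => by
    have h2 : (2 : ℝ) • v = 0 := by rw [two_smul]; nth_rw 1 [hv]; simp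
    simpa using h2
  refine hself _ ?_
  conv_lhs => rw [Finset.sum_comm]
  rw [← Finset.sum_neg_distrib]
  refine Finset.sum_congr rfl fun i _ => ?_
  rw [← Finset.sum_neg_distrib]
  refine Finset.sum_congr rfl fun j _ => ?_
  rw [smul_smul, smul_smul, ← smul_neg, neg_sub, norm_sub_rev (x j)]
  congr 1; ring

/-- This is the principle of symmetric criticality in infinitesimal form: the force never leaves the
symmetric subspace, so variations inside that subspace detect the full equation. -/
theorem accel_mem_fixedSpace {H : Subgroup G} {x : Config n d} (hx : x ∈ S.fixedSpace H) :
    S.accel x ∈ S.fixedSpace H :=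
  ⟨S.accel_mem_configSpace x, fun h hh => by rw [← accel_act, hx.2 h hh]⟩

theorem isOpen_collisionFree : IsOpen {x : Config n d | CollisionFree x} := by
  simp only [CollisionFree, ofPred_forall]
  refine isOpen_iInter_of_finite fun i => isOpen_iInter_of_finite fun j =>
    isOpen_iInter_of_finite fun _ => ?_
  exact (isClosed_eq (continuous_apply i) (continuous_apply j)).isOpen_compl

theorem hasFDerivAt_inv_norm_sub {x : Config n d} {i j : Fin n} (h : x i ≠ x j) :
    HasFDerivAt (fun x : Config n d => ‖x i - x j‖⁻¹)
      (-(‖x i - x j‖ ^ 3)⁻¹ • (innerSL ℝ (x i - x j)).comp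
        ((ContinuousLinearMap.proj i : Config n d →L[ℝ] EuclideanSpace ℝ (Fin d)) -
          ContinuousLinearMap.proj j)) x := by
  have hr : ‖x i - x j‖ ≠ 0 := norm_ne_zero_iff.2 (sub_ne_zero.2 h)
  have h1 : HasFDerivAt (fun x : Config n d => x i - x j)
      ((ContinuousLinearMap.proj i : Config n d →L[ℝ] EuclideanSpace ℝ (Fin d)) -
          ContinuousLinearMap.proj j) x :=
    (hasFDerivAt_apply i x).sub (hasFDerivAt_apply j x)
  have h2 := h1.norm_sq.sqrt (by positivity)
  simp only [Real.sqrt_sq (norm_nonneg _)] at h2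
  have h3 := (hasDerivAt_inv hr).comp_hasFDerivAt x h2
  refine h3.congr_fderiv ?_
  ext u
  simp
  field_simp

/-- The acceleration is the gradient of the potential for the mass inner product. The derivative is
a sum over pairs `i < j`, whereas the acceleration sums over all ordered pairs; grouping the latter
two by two gives equality. -/
theorem hasFDerivAt_potential {x : Config n d} (h : CollisionFree x) :
    HasFDerivAt S.potential (S.massForm (S.accel x)) x := by
  have h1 : HasFDerivAt S.potential (∑ i, ∑ j ∈ Finset.Ioi i, (S.m i * S.m j) •
      (-(‖x i - x j‖ ^ 3)⁻¹ • (innerSL ℝ (x i - x j)).comp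
        ((ContinuousLinearMap.proj i : Config n d →L[ℝ] EuclideanSpace ℝ (Fin d)) -
          ContinuousLinearMap.proj j))) x := by
    unfold potential
    simp only [div_eq_mul_inv]
    refine HasFDerivAt.fun_sum fun i _ => HasFDerivAt.fun_sum fun j hj => ?_
    exact (hasFDerivAt_inv_norm_sub (h i j (Finset.mem_Ioi.1 hj).ne)).const_mul _
  refine h1.congr_fderiv ?_
  ext1 u
  let a : Fin n → Fin n → ℝ := fun i j =>
    S.m i * (S.m j / ‖x i - x j‖ ^ 3 * inner ℝ (x j - x i) (u i))
  -- The diagonal terms of the acceleration vanish because `x i - x i = 0`, whatever the value of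
  -- the quotient by zero.
  have ha : ∀ i, a i i = 0 := fun i => by simp [a]
  have e1 : S.massForm (S.accel x) u = ∑ i, ∑ j, a i j := by
    simp only [massForm_apply, accel, sum_inner, inner_smul_left, a, Finset.mul_sum]
    simp
  have e2 : ∑ i, ∑ j, a i j = ∑ i, ∑ j ∈ Finset.Ioi i, (a i j + a j i) := by
    have h1 : ∀ i, ∑ j, a i j = ∑ j ∈ Finset.Ioi i, a i j + ∑ j ∈ Finset.Iio i, a i j := by
      intro i
      rw [← Finset.sum_union]
      · refine (Finset.sum_subset (Finset.subset_univ _) fun j _ hj => ?_).symm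
        have : j = i := by
          simp only [Finset.mem_union, Finset.mem_Ioi, Finset.mem_Iio] at hj
          omega
        rw [this, ha]
      · rw [Finset.disjoint_left]
        intro j hj hj'
        exact lt_asymm (Finset.mem_Ioi.1 hj) (Finset.mem_Iio.1 hj')
    simp_rw [h1, Finset.sum_add_distrib]
    congr 1
    exact Finset.sum_comm' (by simp)
  rw [e1, e2]
  simp only [sum_apply]
  refine Finset.sum_congr rfl fun i _ => Finset.sum_congr rfl fun j _ => ?_
  simp only [a, norm_sub_rev (x j) (x i)]
  simp [inner_sub_left]
  ring

theorem continuousAt_accel {x : Config n d} (h : CollisionFree x) : ContinuousAt S.accel x := by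
  refine continuousAt_pi.2 fun i => ?_
  unfold accel
  refine tendsto_finsetSum _ fun j _ => ?_
  by_cases hij : i = j
  · subst hij; simp
  · have hr : ‖x i - x j‖ ^ 3 ≠ 0 := pow_ne_zero _ (norm_ne_zero_iff.2 (sub_ne_zero.2 (h i j hij)))
    have : ContinuousAt (fun x : Config n d => (S.m j / ‖x i - x j‖ ^ 3) • (x j - x i)) x := by
      fun_prop (disch := exact hr)
    exact this

theorem continuous_accel_comp {α : Type*} [TopologicalSpace α] {f : α → Config n d}
    (hf : Continuous f) (h : ∀ t, CollisionFree (f t)) : Continuous fun t => S.accel (f t) :=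
  continuous_iff_continuousAt.2 fun t =>
    ContinuousAt.comp (f := f) (S.continuousAt_accel (h t)) hf.continuousAt

theorem gradient_potential_update {x : Config n d} (h : CollisionFree x) (i : Fin n) :
    gradient (fun z => S.potential (Function.update x i z)) (x i) = S.m i • S.accel x i := by
  refine HasGradientAt.gradient ?_
  rw [hasGradientAt_iff_hasFDerivAt]
  have h1 : HasFDerivAt S.potential (S.massForm (S.accel x)) (Function.update x i (x i)) := by
    rw [Function.update_eq_self]; exact S.hasFDerivAt_potential h
  refine (h1.comp (x i) (hasFDerivAt_update x (x i))).congr_fderiv ?_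
  ext1 w
  simp only [ContinuousLinearMap.comp_apply, massForm_apply, ContinuousLinearMap.pi_apply,
    InnerProductSpace.toDual_apply_apply, inner_smul_left]
  rw [Finset.sum_eq_single i]
  · simp
  · intro j _ hj; simp [hj]
  · simp

theorem potential_nonneg (x : Config n d) : 0 ≤ S.potential x :=
  Finset.sum_nonneg fun i _ => Finset.sum_nonneg fun j _ =>
    div_nonneg (mul_nonneg (S.m_pos i).le (S.m_pos j).le) (norm_nonneg _)

end SymmetricSystem
end NBody

/-! ### First variation of the action -/

namespace NBody
namespace SymmetricSystem

variable {G : Type*} [Group G] {n d : ℕ} (S : SymmetricSystem G n d)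

theorem continuous_kinetic : Continuous S.kinetic := by
  unfold kinetic; fun_prop

theorem integrable_kinetic {a b : ℝ} {v : ℝ → Config n d}
    (hv : MemLp v 2 (volume.restrict (Ioo a b))) :
    Integrable (fun t => S.kinetic (v t)) (volume.restrict (Ioo a b)) := by
  have h1 : Integrable (fun t => ‖v t‖ ^ 2) (volume.restrict (Ioo a b)) :=
    hv.integrable_norm_pow (by norm_num)
  refine (h1.const_mul (2⁻¹ * ‖S.massForm‖)).mono'
    (S.continuous_kinetic.comp_aestronglyMeasurable hv.1) (Filter.Eventually.of_forall fun t => ?_)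
  rw [kinetic_eq, norm_mul, mul_assoc, Real.norm_of_nonneg (by norm_num : (0 : ℝ) ≤ 2⁻¹)]
  gcongr
  calc _ ≤ ‖S.massForm‖ * ‖v t‖ * ‖v t‖ := S.massForm.le_opNorm₂ _ _
    _ = _ := by ring

theorem hasDerivAt_kinetic (v w : Config n d) (ε : ℝ) :
    HasDerivAt (fun ε : ℝ => S.kinetic (v + ε • w)) (S.massForm (v + ε • w) w) ε := by
  have h : (fun ε : ℝ => S.kinetic (v + ε • w)) = fun ε =>
      S.kinetic v + ε * S.massForm v w + ε ^ 2 * S.kinetic w := by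
    ext ε
    simp only [kinetic_eq, map_add, map_smul, add_apply, smul_eq_mul,
      smul_apply, S.massForm_comm w v]
    ring
  rw [h]
  have h1 := ((hasDerivAt_id ε).mul_const (S.massForm v w)).const_add (S.kinetic v) |>.add
    ((hasDerivAt_pow 2 ε).mul_const (S.kinetic w))
  refine h1.congr_deriv ?_
  simp only [kinetic_eq, map_add, map_smul, add_apply, smul_eq_mul,
      smul_apply]
  push_cast
  ring

theorem hasDerivAt_potential_line {x u : Config n d} {ε : ℝ} (h : CollisionFree (x + ε • u)) :
    HasDerivAt (fun ε : ℝ => S.potential (x + ε • u)) (S.massForm (S.accel (x + ε • u)) u) ε := by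
  have h1 : HasDerivAt (fun ε : ℝ => x + ε • u) u ε := by
    simpa using ((hasDerivAt_id ε).smul_const u).const_add x
  exact (S.hasFDerivAt_potential h).comp_hasDerivAt ε h1

theorem toReal_action {a b : ℝ} {z w : ℝ → Config n d}
    (hz : ContinuousOn z (Icc a b)) (hw : IsL2WeakDerivOn a b z w)
    (hfree : ∀ t ∈ Icc a b, CollisionFree (z t)) :
    (S.action a b z).toReal = ∫ t in Ioo a b, (S.kinetic (w t) + S.potential (z t)) := by
  have hU : AEStronglyMeasurable (fun t => S.potential (z t)) (volume.restrict (Ioo a b)) := by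
    refine ContinuousOn.aestronglyMeasurable (fun t ht => ?_) measurableSet_Ioo
    have ht' := Ioo_subset_Icc_self ht
    exact (S.hasFDerivAt_potential (hfree t ht')).continuousAt.comp_continuousWithinAt
      ((hz t ht').mono Ioo_subset_Icc_self)
  have hK : AEStronglyMeasurable (fun t => S.kinetic (w t)) (volume.restrict (Ioo a b)) :=
    S.continuous_kinetic.comp_aestronglyMeasurable hw.2.1
  rw [integral_eq_lintegral_of_nonneg_ae (Filter.Eventually.of_forall fun t =>
    add_nonneg (S.kinetic_nonneg _) (S.potential_nonneg _)) (hK.add hU), action,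
    ← setLIntegral_congr Ioo_ae_eq_Icc]
  congr 1
  refine lintegral_congr_ae ?_
  filter_upwards [weakDeriv_ae_eq hw, ae_restrict_mem measurableSet_Ioo] with t h1 h2
  rw [h1, extPotential, if_pos (hfree t (Ioo_subset_Icc_self h2)),
    ENNReal.ofReal_add (S.kinetic_nonneg _) (S.potential_nonneg _)]

/-- The first variation of the action at a collision-free path. -/
theorem hasDerivAt_action {a b : ℝ} (hab : a ≤ b) {y v φ φ' : ℝ → Config n d}
    (hy : ContinuousOn y (Icc a b)) (hv : IsL2WeakDerivOn a b y v)
    (hfree : ∀ t ∈ Icc a b, CollisionFree (y t))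
    (hφ : ∀ t, HasDerivAt φ (φ' t) t) (hφ' : Continuous φ') :
    HasDerivAt (fun ε : ℝ => (S.action a b (y + ε • φ)).toReal)
      (∫ t in Ioo a b, (S.massForm (v t) (φ' t) + S.massForm (S.accel (y t)) (φ t))) 0 := by
  have hφc : Continuous φ := continuous_iff_continuousAt.2 fun t => (hφ t).continuousAt
  have hw := isL2WeakDerivOn_of_hasDerivAt hab hφ hφ'
  -- `y` is continuous only on the closed interval; extending it by its end values makes it
  -- continuous on the line and keeps it collision-free.
  set yc : ℝ → Config n d := IccExtend hab (fun t : Icc a b => y t)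
  have hycc : Continuous yc := by
    refine Continuous.Icc_extend' ?_
    exact continuousOn_iff_continuous_domRestrict.1 hy
  have hyeq : ∀ t ∈ Icc a b, yc t = y t := fun t ht => IccExtend_of_mem hab _ ht
  have hfc : ∀ t, CollisionFree (yc t) := fun t => hfree _ (projIcc a b hab t).2
  have hjc : Continuous fun p : ℝ × ℝ => yc p.2 + p.1 • φ p.2 := by fun_prop
  -- Being collision-free is an open condition, so compactness of the interval gives one range of
  -- `ε` valid for all times.
  have hev : ∀ᶠ ε : ℝ in nhds 0, ∀ t ∈ Icc a b, CollisionFree (yc t + ε • φ t) := by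
    refine isCompact_Icc.eventually_forall_of_forall_eventually fun t _ => ?_
    exact hjc.continuousAt.eventually (isOpen_collisionFree.mem_nhds (by simpa using hfc t))
  obtain ⟨δ, hδ, hδ'⟩ := Metric.eventually_nhds_iff_ball.1 hev
  have hy2 : ∀ ε ∈ Metric.ball (0 : ℝ) δ, ∀ t ∈ Icc a b, CollisionFree (y t + ε • φ t) :=
    fun ε hε t ht => by simpa [hyeq t ht] using hδ' ε hε t ht
  -- Half of `δ` keeps the compact interval `[-r, r]` inside the collision-free range, which yields
  -- the bound `C` below; `r ≤ 1` serves to bound `ε • φ'` by `M`.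
  set r := min (δ / 2) 1
  have hr0 : 0 < r := lt_min (by linarith) one_pos
  have hcomp : ContinuousOn
      (fun p : ℝ × ℝ => S.massForm (S.accel (yc p.2 + p.1 • φ p.2)) (φ p.2))
      (Icc (-r) r ×ˢ Icc a b) := by
    rintro ⟨ε, t⟩ ⟨hε, ht⟩
    have hεδ : ε ∈ Metric.ball (0 : ℝ) δ := by
      rw [Metric.mem_ball, dist_zero_right, Real.norm_eq_abs]
      have : r ≤ δ / 2 := min_le_left _ _
      exact (abs_le.2 hε).trans_lt (by linarith)
    have h1 : ContinuousAt (fun p : ℝ × ℝ => S.accel (yc p.2 + p.1 • φ p.2)) (ε, t) :=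
      ContinuousAt.comp (f := fun p : ℝ × ℝ => yc p.2 + p.1 • φ p.2)
        (S.continuousAt_accel (hδ' ε hεδ t ht)) hjc.continuousAt
    have h2 : ContinuousAt (fun p : ℝ × ℝ => φ p.2) (ε, t) := by fun_prop
    exact ((S.massForm.continuous.continuousAt.comp h1).clm_apply h2).continuousWithinAt
  obtain ⟨C, hC⟩ := (isCompact_Icc.prod isCompact_Icc).exists_bound_of_continuousOn hcomp
  obtain ⟨M, hM⟩ := isCompact_Icc.exists_bound_of_continuousOn (hφ'.continuousOn (s := Icc a b))
  have hmeas : ∀ ε ∈ Metric.ball (0 : ℝ) δ,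
      AEStronglyMeasurable (fun t => S.kinetic (v t + ε • φ' t) + S.potential (y t + ε • φ t))
        (volume.restrict (Ioo a b)) := by
    intro ε hε
    refine (S.continuous_kinetic.comp_aestronglyMeasurable
      (hv.2.1.add (hw.2.1.const_smul ε))).add ?_
    refine ContinuousOn.aestronglyMeasurable (fun t ht => ?_) measurableSet_Ioo
    have ht' := Ioo_subset_Icc_self ht
    exact ContinuousAt.comp_continuousWithinAt (f := fun t => y t + ε • φ t)
      (S.hasFDerivAt_potential (hy2 ε hε t ht')).continuousAt
      (((hy t ht').mono Ioo_subset_Icc_self).add (hφc.const_smul ε).continuousWithinAt)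
  have h0 : (0 : ℝ) ∈ Metric.ball (0 : ℝ) δ := Metric.mem_ball_self hδ
  have hUc : ContinuousOn (fun t => S.potential (y t)) (Icc a b) := fun t ht =>
    (S.hasFDerivAt_potential (hfree t ht)).continuousAt.comp_continuousWithinAt (hy t ht)
  have hAc : ContinuousOn (fun t => S.massForm (S.accel (y t)) (φ t)) (Icc a b) := fun t ht =>
    ((S.massForm.continuous.continuousAt.comp_continuousWithinAt
      ((S.continuousAt_accel (hfree t ht)).comp_continuousWithinAt (hy t ht)))).clm_apply
      hφc.continuousWithinAt
  -- Differentiation under the integral: the kinetic part is dominated through `‖v t‖`, integrable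
  -- since `v` is L² on a bounded interval, and the potential part by the constant `C`.
  have key := (hasDerivAt_integral_of_dominated_loc_of_deriv_le
    (μ := volume.restrict (Ioo a b)) (s := Metric.ball (0 : ℝ) r) (x₀ := (0 : ℝ))
    (F := fun ε t => S.kinetic (v t + ε • φ' t) + S.potential (y t + ε • φ t))
    (F' := fun ε t => S.massForm (v t + ε • φ' t) (φ' t) +
      S.massForm (S.accel (y t + ε • φ t)) (φ t))
    (bound := fun t => ‖S.massForm‖ * (‖v t‖ + M) * M + C)
    (Metric.ball_mem_nhds _ hr0) ?_ ?_ ?_ ?_ ?_ ?_).2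
  · have hsimp : (∫ t in Ioo a b, (S.massForm (v t + (0 : ℝ) • φ' t) (φ' t) +
        S.massForm (S.accel (y t + (0 : ℝ) • φ t)) (φ t))) =
        ∫ t in Ioo a b, (S.massForm (v t) (φ' t) + S.massForm (S.accel (y t)) (φ t)) := by
      simp
    rw [← hsimp]
    refine key.congr_of_eventuallyEq ?_
    filter_upwards [Metric.ball_mem_nhds (0 : ℝ) hδ] with ε hε
    exact S.toReal_action (hy.add (hφc.const_smul ε).continuousOn)
      (hv.add_const_smul hy hφc.continuousOn hw ε) (hy2 ε hε)
  · filter_upwards [Metric.ball_mem_nhds (0 : ℝ) hδ] with ε hε using hmeas ε hε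
  · simp only [zero_smul, add_zero]
    exact (S.integrable_kinetic hv.2).add (integrable_Ioo_of_continuousOn hUc)
  · simp only [zero_smul, add_zero]
    refine AEStronglyMeasurable.add ?_ (integrable_Ioo_of_continuousOn hAc).1
    exact S.massForm.aestronglyMeasurable_comp₂ hv.2.1 hw.2.1
  · filter_upwards [ae_restrict_mem measurableSet_Ioo] with t ht ε hε
    have ht' := Ioo_subset_Icc_self ht
    have hε' : |ε| < r := by simpa using hε
    have hε1 : |ε| ≤ 1 := hε'.le.trans (min_le_right _ _)
    refine norm_add_le_of_le ?_ ?_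
    · refine (S.massForm.le_opNorm₂ _ _).trans ?_
      have hM0 := hM t ht'
      have h2 : ‖v t + ε • φ' t‖ ≤ ‖v t‖ + M := by
        refine norm_add_le_of_le le_rfl ?_
        rw [norm_smul, Real.norm_eq_abs]
        calc |ε| * ‖φ' t‖ ≤ 1 * ‖φ' t‖ := by gcongr
          _ ≤ M := by linarith
      have : 0 ≤ M := (norm_nonneg _).trans hM0
      gcongr
    · have := hC (ε, t) ⟨abs_le.1 hε'.le, ht'⟩
      simpa only [hyeq t ht'] using this
  · have h1 : Integrable (fun t => ‖v t‖) (volume.restrict (Ioo a b)) := hv.integrable.norm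
    exact (((h1.add (integrable_const M)).const_mul _).mul_const _).add (integrable_const _)
  · filter_upwards [ae_restrict_mem measurableSet_Ioo] with t ht ε hε
    have hεδ : ε ∈ Metric.ball (0 : ℝ) δ := by
      refine Metric.ball_subset_ball ?_ hε
      have : r ≤ δ / 2 := min_le_left _ _
      linarith
    exact (S.hasDerivAt_kinetic _ _ _).add
      (S.hasDerivAt_potential_line (hy2 ε hεδ t (Ioo_subset_Icc_self ht)))

end SymmetricSystem
end NBody

/-! ### Shifts and reflections of the time circle, and fundamental domains -/

namespace NBody
namespace SymmetricSystem

variable {G : Type*} [Group G] {n d : ℕ} (S : SymmetricSystem G n d)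

theorem timePoint_eq_iff {s t : ℝ} : S.timePoint s = S.timePoint t ↔ ∃ k : ℤ, s = t + k * S.T := by
  have hT := S.T_pos.ne'
  rw [timePoint, timePoint, Circle.coe_inj, Circle.exp_eq_exp]
  refine exists_congr fun k => ?_
  have hpi := Real.pi_ne_zero
  constructor
  · intro h
    field_simp at h
    linarith
  · rintro rfl
    field_simp

theorem timePoint_add (s t : ℝ) : S.timePoint (s + t) = S.timePoint s * S.timePoint t := by
  rw [timePoint, timePoint, timePoint, ← Circle.coe_mul, ← Circle.exp_add]
  congr 2; ring

theorem timePoint_neg (t : ℝ) :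
    S.timePoint (-t) = (starRingEnd ℂ) (S.timePoint t) := by
  rw [timePoint, timePoint, ← Circle.coe_inv_eq_conj, ← Circle.exp_neg]
  congr 2; ring

theorem exists_timePoint_eq (a : Circle) : ∃ t, S.timePoint t = a := by
  obtain ⟨r, rfl⟩ := Circle.exp_surjective a
  refine ⟨S.T * r / (2 * Real.pi), ?_⟩
  have hT := S.T_pos.ne'
  have hpi := Real.pi_ne_zero
  rw [timePoint]
  congr 2
  field_simp

/-- `g` acts on the time circle as the rotation by `c`. -/
def ShiftsTime (g : G) (c : ℝ) : Prop := ∀ t, S.IsTimeImage g t (t + c)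

/-- `g` acts on the time circle as the reflection `t ↦ c - t`. -/
def FlipsTime (g : G) (c : ℝ) : Prop := ∀ t, S.IsTimeImage g t (c - t)

variable {S}

theorem IsTimeImage.mul {g h : G} {t s u : ℝ} (hg : S.IsTimeImage g t s)
    (hh : S.IsTimeImage h s u) : S.IsTimeImage (h * g) t u := by
  unfold IsTimeImage at *
  rw [map_mul, hh, hg]; rfl

theorem IsTimeImage.inv {g : G} {t s : ℝ} (hg : S.IsTimeImage g t s) :
    S.IsTimeImage g⁻¹ s t := by
  unfold IsTimeImage at *
  rw [map_inv, hg]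
  exact ((S.τ g).symm_apply_apply _).symm

theorem IsTimeImage.exists_eq {g : G} {t s s' : ℝ} (h : S.IsTimeImage g t s)
    (h' : S.IsTimeImage g t s') : ∃ k : ℤ, s = s' + k * S.T :=
  S.timePoint_eq_iff.1 (h.trans h'.symm)

theorem IsTimeImage.add_int_mul {g : G} {t s : ℝ} (h : S.IsTimeImage g t s) (k : ℤ) :
    S.IsTimeImage g t (s + k * S.T) :=
  (S.timePoint_eq_iff.2 ⟨k, rfl⟩).trans h

variable (S) in
theorem isTimeImage_one_int (t : ℝ) (k : ℤ) : S.IsTimeImage 1 t (t + k * S.T) :=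
  (S.timePoint_eq_iff.2 ⟨k, rfl⟩).trans (by simp)

variable (S) in
theorem isTimeImage_of_mem_ker {g : G} (hg : g ∈ S.τ.ker) (t : ℝ) : S.IsTimeImage g t t := by
  rw [IsTimeImage, MonoidHom.mem_ker.1 hg]; rfl

theorem exists_shiftsTime_of_mem_range {g : G}
    (hg : S.τ g ∈ (rotation : Circle →* (ℂ ≃ₗᵢ[ℝ] ℂ)).range) : ∃ c, S.ShiftsTime g c := by
  obtain ⟨a, ha⟩ := hg
  obtain ⟨c, hc⟩ := S.exists_timePoint_eq a
  refine ⟨c, fun t => ?_⟩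
  rw [IsTimeImage, ← ha, rotation_apply, ← hc, timePoint_add, mul_comm]

theorem exists_flipsTime_of_notMem_range {g : G}
    (hg : S.τ g ∉ (rotation : Circle →* (ℂ ≃ₗᵢ[ℝ] ℂ)).range) : ∃ c, S.FlipsTime g c := by
  obtain ⟨a, ha | ha⟩ := linear_isometry_complex (S.τ g)
  · exact absurd ⟨a, ha.symm⟩ hg
  obtain ⟨c, hc⟩ := S.exists_timePoint_eq a
  refine ⟨c, fun t => ?_⟩
  rw [IsTimeImage, ha, sub_eq_add_neg, timePoint_add, hc, timePoint_neg]
  rfl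

theorem ShiftsTime.add_int_mul {g : G} {c : ℝ} (h : S.ShiftsTime g c) (k : ℤ) :
    S.ShiftsTime g (c + k * S.T) := fun t => by
  rw [← add_assoc]; exact (h t).add_int_mul k

theorem FlipsTime.add_int_mul {g : G} {c : ℝ} (h : S.FlipsTime g c) (k : ℤ) :
    S.FlipsTime g (c + k * S.T) := fun t => by
  rw [add_sub_right_comm]; exact (h t).add_int_mul k

variable (S) in
theorem shiftsTime_or_flipsTime (g : G) : (∃ c, S.ShiftsTime g c) ∨ ∃ c, S.FlipsTime g c :=
  (em _).imp exists_shiftsTime_of_mem_range exists_flipsTime_of_notMem_range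

/-- The amount of a shift matters only modulo the period, so it may be read off from any one instant
and its image. -/
theorem ShiftsTime.of_isTimeImage {g : G} {c t s : ℝ} (h : S.ShiftsTime g c)
    (hi : S.IsTimeImage g t s) : S.ShiftsTime g (s - t) := by
  obtain ⟨k, hk⟩ := hi.exists_eq (h t)
  have := h.add_int_mul k
  rwa [show c + k * S.T = s - t by rw [hk]; ring] at this

theorem FlipsTime.of_isTimeImage {g : G} {c t s : ℝ} (h : S.FlipsTime g c)
    (hi : S.IsTimeImage g t s) : S.FlipsTime g (s + t) := by
  obtain ⟨k, hk⟩ := hi.exists_eq (h t)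
  have := h.add_int_mul k
  rwa [show c + k * S.T = s + t by rw [hk]; ring] at this

variable (S) in
theorem shiftsTime_one (k : ℤ) : S.ShiftsTime 1 (k * S.T) := fun t => S.isTimeImage_one_int t k

theorem ShiftsTime.mul {g h : G} {c e : ℝ} (hg : S.ShiftsTime g c) (hh : S.ShiftsTime h e) :
    S.ShiftsTime (h * g) (c + e) := fun t => by
  rw [← add_assoc]; exact (hg t).mul (hh _)

theorem ShiftsTime.inv {g : G} {c : ℝ} (hg : S.ShiftsTime g c) : S.ShiftsTime g⁻¹ (-c) :=
  fun t => by simpa using (hg (t + -c)).inv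

theorem ShiftsTime.pow {g : G} {c : ℝ} (hg : S.ShiftsTime g c) (k : ℕ) :
    S.ShiftsTime (g ^ k) (k * c) := by
  induction k with
  | zero => simpa using S.shiftsTime_one 0
  | succ k ih =>
    rw [pow_succ']
    have := ih.mul hg
    rwa [show ((k + 1 : ℕ) : ℝ) * c = k * c + c by push_cast; ring]

theorem ShiftsTime.zpow {g : G} {c : ℝ} (hg : S.ShiftsTime g c) (k : ℤ) :
    S.ShiftsTime (g ^ k) (k * c) := by
  obtain ⟨j, rfl | rfl⟩ := k.eq_nat_or_neg
  · simpa using hg.pow j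
  · simpa using (hg.pow j).inv

theorem FlipsTime.mul {g h : G} {c e : ℝ} (hg : S.FlipsTime g c) (hh : S.FlipsTime h e) :
    S.ShiftsTime (h * g) (e - c) := fun t => by
  have := (hg t).mul (hh _)
  rwa [show e - (c - t) = t + (e - c) by ring] at this

theorem ShiftsTime.mul_flip {g h : G} {c e : ℝ} (hg : S.ShiftsTime g c) (hh : S.FlipsTime h e) :
    S.FlipsTime (h * g) (e - c) := fun t => by
  have := (hg t).mul (hh _)
  rwa [show e - (t + c) = e - c - t by ring] at this

/-- Every complex number is a real multiple of a point of the circle, so a linear map fixing the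
circle is the identity. -/
theorem ShiftsTime.mem_ker {g : G} (h : S.ShiftsTime g 0) : g ∈ S.τ.ker := by
  rw [MonoidHom.mem_ker]
  ext1 z
  obtain ⟨t, ht⟩ := S.exists_timePoint_eq (Circle.exp z.arg)
  have h1 : S.τ g (S.timePoint t) = S.timePoint t := by
    have := h t
    rw [add_zero] at this
    exact this.symm
  have hz : z = ‖z‖ • S.timePoint t := by
    rw [ht, Circle.coe_exp, Complex.real_smul, Complex.norm_mul_exp_arg_mul_I]
  calc S.τ g z = ‖z‖ • S.τ g (S.timePoint t) := by rw [← map_smul, ← hz]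
    _ = z := by rw [h1, ← hz]

variable (S) in
theorem ker_le_isotropy (t : ℝ) : S.τ.ker ≤ S.isotropy t := fun _ hg =>
  (S.isTimeImage_of_mem_ker hg t).symm

/-- If the isotropy group of `s` lies in that of `u`, the reflection `g` fixes both, so `2 * u` and
`2 * s` agree modulo the period. Any `h` fixing `u` is then in the kernel or a reflection with the
same centre data, and so fixes `s`. -/
theorem isMaximalIsotropy_of_flipsTime {g : G} {s : ℝ} (hg : S.FlipsTime g (2 * s)) :
    S.IsMaximalIsotropy s := by
  refine ⟨⟨s, rfl⟩, ?_⟩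
  rintro K ⟨u, rfl⟩ hle h hh
  have hgs : g ∈ S.isotropy s := by
    have := hg s
    rw [two_mul, add_sub_cancel_right] at this
    exact this.symm
  have hgu : S.IsTimeImage g u u := (hle hgs).symm
  have hhu : S.IsTimeImage h u u := Eq.symm hh
  obtain ⟨k, hk⟩ := hgu.exists_eq (hg u)
  rcases S.shiftsTime_or_flipsTime h with ⟨c, hc⟩ | ⟨c, hc⟩
  · have := hc.of_isTimeImage hhu
    rw [sub_self] at this
    exact S.ker_le_isotropy s this.mem_ker
  · have h1 := (hc.of_isTimeImage hhu).add_int_mul (-k) s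
    have h2 : u + u + ((-k : ℤ) : ℝ) * S.T - s = s := by push_cast; linarith
    rw [h2] at h1
    exact h1.symm

/-- Without a reflection at `t` the isotropy group there would be only `ker τ`. Some reflection
exists, fixing `c / 2`, and the isotropy group of that instant is larger, against maximality. -/
theorem IsMaximalIsotropy.exists_flipsTime (hS : ¬ S.IsCyclicType) {t : ℝ}
    (ht : S.IsMaximalIsotropy t) : ∃ g, S.FlipsTime g (2 * t) := by
  rw [IsCyclicType, not_forall] at hS
  obtain ⟨h, hh⟩ := hS
  obtain ⟨c, hc⟩ := exists_flipsTime_of_notMem_range hh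
  by_contra! hno
  have hker : ∀ g ∈ S.isotropy t, g ∈ S.τ.ker := by
    intro g hg
    have hgt : S.IsTimeImage g t t := Eq.symm hg
    rcases S.shiftsTime_or_flipsTime g with ⟨e, he⟩ | ⟨e, he⟩
    · have := he.of_isTimeImage hgt
      rw [sub_self] at this
      exact this.mem_ker
    · have := he.of_isTimeImage hgt
      rw [← two_mul] at this
      exact absurd this (hno g)
  have hle : S.isotropy t ≤ S.isotropy (c / 2) := fun g hg => S.ker_le_isotropy _ (hker g hg)
  have hhc : h ∈ S.isotropy (c / 2) := by
    have := hc (c / 2)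
    rw [sub_half] at this
    exact this.symm
  have hht : S.IsTimeImage h t t := Eq.symm (ht.2 ⟨c / 2, rfl⟩ hle hhc)
  have := hc.of_isTimeImage hht
  rw [← two_mul] at this
  exact hno h this

theorem IsCyclicType.exists_shiftsTime (hS : S.IsCyclicType) (g : G) : ∃ c, S.ShiftsTime g c :=
  exists_shiftsTime_of_mem_range (hS g)

theorem ShiftsTime.exists_isTimeImage_mem {g : G} {c a b : ℝ} (hg : S.ShiftsTime g c) (hc : 0 < c)
    (h : ∀ s ∈ Ico a (a + c), ∃ g, ∃ t ∈ Icc a b, S.IsTimeImage g t s) (s : ℝ) :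
    ∃ g, ∃ t ∈ Icc a b, S.IsTimeImage g t s := by
  obtain ⟨j, hj, -⟩ := existsUnique_add_zsmul_mem_Ico hc s a
  obtain ⟨g', t, ht, hgt⟩ := h _ hj
  refine ⟨g ^ (-j) * g', t, ht, ?_⟩
  have := hgt.mul (hg.zpow (-j) _)
  rwa [show s + j • c + ((-j : ℤ) : ℝ) * c = s by rw [zsmul_eq_mul]; push_cast; ring] at this

variable [Finite G]

theorem card_quotient_ker_pos : 0 < Nat.card (G ⧸ S.τ.ker) := Nat.card_pos

/-- The power of `g` by the order of `G ⧸ ker τ` acts trivially on time, so that multiple of `c` is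
a whole number of periods. -/
theorem ShiftsTime.exists_int {g : G} {c : ℝ} (hg : S.ShiftsTime g c) :
    ∃ j : ℤ, c = j * (S.T / Nat.card (G ⧸ S.τ.ker)) := by
  have hk : (0 : ℝ) < Nat.card (G ⧸ S.τ.ker) := Nat.cast_pos.2 (card_quotient_ker_pos (S := S))
  have hmem : g ^ Nat.card (G ⧸ S.τ.ker) ∈ S.τ.ker := by
    rw [← QuotientGroup.eq_one_iff, QuotientGroup.mk_pow, pow_card_eq_one']
  obtain ⟨j, hj⟩ := (hg.pow _ 0).exists_eq (S.isTimeImage_of_mem_ker hmem 0)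
  refine ⟨j, ?_⟩
  rw [zero_add, zero_add] at hj
  field_simp
  linarith

/-- A counting argument: each of the `k` cosets of `ker τ` shifts time by a residue modulo `k` in
units of `T / k`, and distinct cosets give distinct residues. All residues occur, in particular that
of one. -/
theorem IsCyclicType.exists_generator (hS : S.IsCyclicType) :
    ∃ g, S.ShiftsTime g (S.T / Nat.card (G ⧸ S.τ.ker)) := by
  set k := Nat.card (G ⧸ S.τ.ker) with hkdef
  have hkpos : 0 < k := card_quotient_ker_pos (S := S)
  have hk : (k : ℝ) ≠ 0 := Nat.cast_ne_zero.2 hkpos.ne'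
  have hex : ∀ q : G ⧸ S.τ.ker, ∃ j : Fin k, S.ShiftsTime q.out (j * (S.T / k)) := by
    intro q
    obtain ⟨c, hc⟩ := hS.exists_shiftsTime q.out
    obtain ⟨j, hj⟩ := hc.exists_int
    have hk' : (k : ℤ) ≠ 0 := by exact_mod_cast hkpos.ne'
    have hnn := Int.emod_nonneg j hk'
    have hlt := Int.emod_lt_of_pos j (b := (k : ℤ)) (by exact_mod_cast hkpos)
    refine ⟨⟨(j % k).toNat, by omega⟩, ?_⟩
    have h1 := hc.add_int_mul (-(j / k))
    have h2 : (((j % k).toNat : ℕ) : ℝ) = j - k * ((j / k : ℤ) : ℝ) := by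
      have : (((j % k).toNat : ℕ) : ℤ) = j - k * (j / k) := by
        rw [Int.toNat_of_nonneg hnn]; linarith [Int.emod_add_mul_ediv j k]
      exact_mod_cast this
    change S.ShiftsTime q.out ((((j % k).toNat : ℕ) : ℝ) * (S.T / k))
    rw [h2]
    rw [hj] at h1
    have h3 : (j : ℝ) * (S.T / k) + ((-(j / k) : ℤ) : ℝ) * S.T =
        (j - k * ((j / k : ℤ) : ℝ)) * (S.T / k) := by
      push_cast; field_simp; ring
    rwa [← h3]
  choose f hf using hex
  have hinj : Function.Injective f := by
    intro q q' hqq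
    have h1 := (hf q').mul (hf q).inv
    rw [hqq, add_neg_cancel] at h1
    rw [← q.out_eq, ← q'.out_eq]
    exact QuotientGroup.eq.2 h1.mem_ker
  have hbij : Function.Bijective f := hinj.bijective_of_nat_card_le (by simp [hkdef])
  -- For `k = 1` the residue is `0`, and the `1 / k` extra periods added below restore the shift by
  -- `T`.
  obtain ⟨q, hq⟩ := hbij.2 ⟨1 % k, Nat.mod_lt _ hkpos⟩
  refine ⟨q.out, ?_⟩
  have h1 := (hf q).add_int_mul ((1 / k : ℕ) : ℤ)
  rw [hq] at h1
  have h2 : ((1 % k : ℕ) : ℝ) = 1 - k * ((1 / k : ℕ) : ℝ) := by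
    have := Nat.mod_add_div 1 k
    have h' : ((1 % k : ℕ) : ℝ) + k * ((1 / k : ℕ) : ℝ) = 1 := by exact_mod_cast this
    linarith
  have h3 : (((⟨1 % k, Nat.mod_lt _ hkpos⟩ : Fin k) : ℕ) : ℝ) * (S.T / k) +
      (((1 / k : ℕ) : ℤ) : ℝ) * S.T = S.T / k := by
    change ((1 % k : ℕ) : ℝ) * (S.T / k) + (((1 / k : ℕ) : ℤ) : ℝ) * S.T = S.T / k
    rw [h2, Int.cast_natCast]; field_simp; ring
  rwa [h3] at h1

variable {t₀ t₁ : ℝ}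

theorem IsFundamentalDomain.lt (hI : S.IsFundamentalDomain t₀ t₁) : t₀ < t₁ := by
  by_cases hS : S.IsCyclicType
  · rw [hI.1 hS]
    have : (0 : ℝ) < Nat.card (G ⧸ S.τ.ker) := Nat.cast_pos.2 (card_quotient_ker_pos (S := S))
    have := div_pos S.T_pos this
    linarith
  · exact (hI.2 hS).1

theorem IsFundamentalDomain.exists_shiftsTime (hI : S.IsFundamentalDomain t₀ t₁)
    (hS : S.IsCyclicType) : ∃ g, S.ShiftsTime g (t₁ - t₀) := by
  rw [hI.1 hS, add_sub_cancel_left]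
  exact hS.exists_generator

/-- Every instant is the image of one in the fundamental domain. -/
theorem IsFundamentalDomain.exists_isTimeImage (hI : S.IsFundamentalDomain t₀ t₁) (s : ℝ) :
    ∃ g, ∃ t ∈ Icc t₀ t₁, S.IsTimeImage g t s := by
  have hlt := hI.lt
  have hone : ∀ t, S.IsTimeImage 1 t t := fun t => by simpa using S.isTimeImage_one_int t 0
  by_cases hS : S.IsCyclicType
  · obtain ⟨g, hg⟩ := hI.exists_shiftsTime hS
    refine hg.exists_isTimeImage_mem (by linarith) (fun s hs => ⟨1, s, ⟨hs.1, ?_⟩, hone s⟩) s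
    linarith [hs.2]
  · obtain ⟨-, h0, h1, -⟩ := hI.2 hS
    obtain ⟨g₀, hg₀⟩ := h0.exists_flipsTime hS
    obtain ⟨g₁, hg₁⟩ := h1.exists_flipsTime hS
    -- The two end reflections compose to the shift by `2 * (t₁ - t₀)`; one such period is the
    -- domain followed by its mirror image about `t₁`.
    refine (hg₀.mul hg₁).exists_isTimeImage_mem (by linarith) (fun s hs => ?_) s
    rcases le_total s t₁ with hle | hle
    · exact ⟨1, s, ⟨hs.1, hle⟩, hone s⟩
    · refine ⟨g₁, 2 * t₁ - s, ⟨by linarith [hs.2], by linarith⟩, ?_⟩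
      have := hg₁ (2 * t₁ - s)
      rwa [sub_sub_cancel] at this

/-- The paths in `Y` are compatible with all identifications inside the fundamental domain. -/
theorem IsFundamentalDomain.act_eq (hI : S.IsFundamentalDomain t₀ t₁) {y : ℝ → Config n d}
    (hy : y ∈ S.pathSpace t₀ t₁) {h : G} {t t' : ℝ} (ht : t ∈ Icc t₀ t₁) (ht' : t' ∈ Icc t₀ t₁)
    (hi : S.IsTimeImage h t t') : S.act h (y t) = y t' := by
  have hlt := hI.lt
  obtain ⟨-, hker, hcyc, hdih⟩ := hy
  have hzero : ∀ {h : G} {t t' : ℝ}, t ∈ Icc t₀ t₁ → S.ShiftsTime h (t' - t) → t = t' →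
      S.act h (y t) = y t' := by
    rintro h t t' ht hh rfl
    rw [sub_self] at hh
    exact (hker t ht).2 h hh.mem_ker
  by_cases hS : S.IsCyclicType
  · obtain ⟨c, hc⟩ := hS.exists_shiftsTime h
    have hsh := hc.of_isTimeImage hi
    obtain ⟨j, hj⟩ := hsh.exists_int
    have hL : S.T / Nat.card (G ⧸ S.τ.ker) = t₁ - t₀ := by rw [hI.1 hS]; ring
    rw [hL] at hj
    have hLpos : 0 < t₁ - t₀ := by linarith
    -- Both instants lie in an interval whose length is the unit shift, so only `j = -1, 0, 1` can
    -- occur, the extreme values exchanging the endpoints.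
    have hj1 : j ≤ 1 := by
      by_contra! hc
      have hc' : (2 : ℝ) ≤ j := by exact_mod_cast hc
      nlinarith [ht.1, ht'.2]
    have hj2 : -1 ≤ j := by
      by_contra! hc
      have hc' : (j : ℝ) ≤ -2 := by exact_mod_cast (by omega : j ≤ -2)
      nlinarith [ht.2, ht'.1]
    obtain rfl | rfl | rfl : j = -1 ∨ j = 0 ∨ j = 1 := by omega
    · push_cast at hj
      obtain rfl : t = t₁ := by linarith [ht.2, ht'.1]
      obtain rfl : t' = t₀ := by linarith
      have := hcyc hS h⁻¹ hi.inv
      rw [← this, act_act_inv]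
    · exact hzero ht hsh (by push_cast at hj; linarith)
    · push_cast at hj
      obtain rfl : t = t₀ := by linarith [ht.1, ht'.2]
      obtain rfl : t' = t₁ := by linarith
      exact hcyc hS h hi
  · obtain ⟨-, h0, h1, hmax⟩ := hI.2 hS
    rcases S.shiftsTime_or_flipsTime h with ⟨c, hc⟩ | ⟨c, hc⟩
    · have hsh := hc.of_isTimeImage hi
      obtain ⟨g₀, hg₀⟩ := h0.exists_flipsTime hS
      rcases lt_trichotomy t t' with hlt' | heq | hlt'
      -- A nontrivial shift inside the domain, composed with the reflection at `t₀`, would be a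
      -- reflection about an interior instant, which is excluded.
      · refine absurd (isMaximalIsotropy_of_flipsTime (s := t₀ + (t' - t) / 2) (g := g₀ * h⁻¹) ?_)
          (hmax _ ⟨by linarith, by linarith [ht.1, ht'.2]⟩)
        have := hsh.inv.mul_flip hg₀
        rwa [show 2 * t₀ - -(t' - t) = 2 * (t₀ + (t' - t) / 2) by ring] at this
      · exact hzero ht hsh heq
      · refine absurd (isMaximalIsotropy_of_flipsTime (s := t₀ + (t - t') / 2) (g := g₀ * h) ?_)
          (hmax _ ⟨by linarith, by linarith [ht.2, ht'.1]⟩)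
        have := hsh.mul_flip hg₀
        rwa [show 2 * t₀ - (t' - t) = 2 * (t₀ + (t - t') / 2) by ring] at this
    · have hfl := hc.of_isTimeImage hi
      rw [show t' + t = 2 * ((t' + t) / 2) by ring] at hfl
      -- The centre of the reflection cannot be interior either; the midpoint of `t` and `t'` is
      -- therefore an endpoint, and both coincide with it.
      have hmid : ¬ (t₀ < (t' + t) / 2 ∧ (t' + t) / 2 < t₁) := fun hm =>
        hmax _ hm (isMaximalIsotropy_of_flipsTime hfl)
      rw [not_and_or, not_lt, not_lt] at hmid
      rcases hmid with hm | hm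
      · obtain rfl : t = t₀ := by linarith [ht.1, ht'.1]
        obtain rfl : t' = t := by linarith [ht'.1]
        exact (hdih hS).1.2 h hi.symm
      · obtain rfl : t = t₁ := by linarith [ht.2, ht'.2]
        obtain rfl : t' = t := by linarith [ht'.2]
        exact (hdih hS).2.2 h hi.symm

/-- The pair chosen in the definition and the given one differ by an identification inside the
domain, to which `IsFundamentalDomain.act_eq` applies. -/
theorem IsFundamentalDomain.symmetrised_eq (hI : S.IsFundamentalDomain t₀ t₁)
    {y : ℝ → Config n d} (hy : y ∈ S.pathSpace t₀ t₁) {g : G} {t s : ℝ} (ht : t ∈ Icc t₀ t₁)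
    (hi : S.IsTimeImage g t s) : S.symmetrised t₀ t₁ y s = S.act g (y t) := by
  have h : ∃ p : G × ℝ, p.2 ∈ Icc t₀ t₁ ∧ S.IsTimeImage p.1 p.2 s := ⟨(g, t), ht, hi⟩
  rw [symmetrised, dif_pos h]
  obtain ⟨h1, h2⟩ := h.choose_spec
  have := hI.act_eq hy h1 ht (h2.mul hi.inv)
  rw [← this, act_mul, act_act_inv]

theorem IsFundamentalDomain.symmetrised_eqOn (hI : S.IsFundamentalDomain t₀ t₁)
    {y : ℝ → Config n d} (hy : y ∈ S.pathSpace t₀ t₁) :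
    EqOn (S.symmetrised t₀ t₁ y) y (Icc t₀ t₁) := fun t ht => by
  rw [hI.symmetrised_eq hy ht (g := 1) (by simpa using S.isTimeImage_one_int t 0), act_one]

theorem IsFundamentalDomain.symmetrised_equivariant (hI : S.IsFundamentalDomain t₀ t₁)
    {y : ℝ → Config n d} (hy : y ∈ S.pathSpace t₀ t₁) {g : G} {t s : ℝ}
    (hi : S.IsTimeImage g t s) :
    S.symmetrised t₀ t₁ y s = S.act g (S.symmetrised t₀ t₁ y t) := by
  obtain ⟨h, u, hu, hut⟩ := hI.exists_isTimeImage t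
  rw [hI.symmetrised_eq hy hu hut, hI.symmetrised_eq hy hu (hut.mul hi), act_mul]

end SymmetricSystem
end NBody

/-! ### Regularity of critical points and natural boundary conditions -/

namespace NBody
namespace SymmetricSystem

variable {G : Type*} [Group G] {n d : ℕ} {S : SymmetricSystem G n d} {t₀ t₁ : ℝ}
  {y : ℝ → Config n d}

theorem IsCriticalPoint.integral_eq_zero (hcrit : S.IsCriticalPoint t₀ t₁ y) (hlt : t₀ ≤ t₁)
    (hfree : ∀ t ∈ Icc t₀ t₁, CollisionFree (y t)) {v φ φ' : ℝ → Config n d}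
    (hv : IsL2WeakDerivOn t₀ t₁ y v) (hφ : ∀ t, HasDerivAt φ (φ' t) t) (hφ' : Continuous φ')
    (hmem : φ ∈ S.pathSpace t₀ t₁) :
    ∫ t in Ioo t₀ t₁, (S.massForm (v t) (φ' t) + S.massForm (S.accel (y t)) (φ t)) = 0 :=
  (S.hasDerivAt_action hlt hcrit.1.1.1 hv hfree hφ hφ').unique (hcrit.2 φ hmem)

theorem smul_mem_pathSpace (hlt : t₀ ≤ t₁) {η : ℝ → ℝ} (hη : IsTestFun t₀ t₁ η)
    {w : Config n d} (hw : w ∈ S.fixedSpace S.τ.ker) :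
    (fun t => η t • w) ∈ S.pathSpace t₀ t₁ := by
  have h0 : η t₀ = 0 := hη.eq_zero (by simp)
  have h1 : η t₁ = 0 := hη.eq_zero (by simp)
  refine ⟨memH1_of_hasDerivAt hlt (q' := fun t => deriv η t • w) (fun t => ?_) ?_,
    fun t _ => (S.fixedSubmodule _).smul_mem _ hw, fun _ g _ => ?_, fun _ => ?_⟩
  · exact ((hη.contDiff.differentiable (by simp) t).hasDerivAt).smul_const w
  · exact hη.deriv.continuous.smul continuous_const
  · simp only [h0, h1, zero_smul, act_zero]
  · simp only [h0, h1, zero_smul]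
    exact ⟨(S.fixedSubmodule _).zero_mem, (S.fixedSubmodule _).zero_mem⟩

/-- A collision-free critical point is of class `C²` up to the boundary and solves Newton's
equations; its velocity stays in `𝒳^{ker τ}`. -/
theorem IsCriticalPoint.exists_hasDerivAt (hcrit : S.IsCriticalPoint t₀ t₁ y) (hlt : t₀ < t₁)
    (hfree : ∀ t ∈ Icc t₀ t₁, CollisionFree (y t)) :
    ∃ Y W A : ℝ → Config n d, EqOn Y y (Icc t₀ t₁) ∧ (∀ t, HasDerivAt Y (W t) t) ∧
      (∀ t, HasDerivAt W (A t) t) ∧ Continuous A ∧ (∀ t ∈ Icc t₀ t₁, A t = S.accel (y t)) ∧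
      ∀ t, W t ∈ S.fixedSpace S.τ.ker := by
  obtain ⟨⟨hyc, v, hv⟩, hker, -, -⟩ := hcrit.1
  set V := S.fixedSubmodule S.τ.ker
  have : CompleteSpace V := FiniteDimensional.complete ℝ V
  set yc : ℝ → Config n d := IccExtend hlt.le (fun t : Icc t₀ t₁ => y t)
  have hycc : Continuous yc :=
    Continuous.Icc_extend' (continuousOn_iff_continuous_domRestrict.1 hyc)
  have hyeq : ∀ t ∈ Icc t₀ t₁, yc t = y t := fun t ht => IccExtend_of_mem hlt.le _ ht
  have hfc : ∀ t, CollisionFree (yc t) := fun t => hfree _ (projIcc t₀ t₁ hlt.le t).2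
  have hkc : ∀ t, yc t ∈ S.fixedSpace S.τ.ker := fun t => hker _ (projIcc t₀ t₁ hlt.le t).2
  -- Integrating inside `V` keeps the velocity and the double primitive in the symmetric subspace.
  let F : ℝ → V := fun t => ⟨S.accel (yc t), S.accel_mem_fixedSpace (hkc t)⟩
  have hF : Continuous F := (S.continuous_accel_comp hycc hfc).subtype_mk _
  let W' : ℝ → V := fun t => ∫ s in t₀..t, F s
  have hW' : ∀ t, HasDerivAt W' (F t) t := fun t =>
    (hF.integral_hasStrictDerivAt t₀ t).hasDerivAt
  have hW'c : Continuous W' := continuous_iff_continuousAt.2 fun t => (hW' t).continuousAt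
  let Y' : ℝ → V := fun t => ∫ s in t₀..t, W' s
  have hY' : ∀ t, HasDerivAt Y' (W' t) t := fun t =>
    (hW'c.integral_hasStrictDerivAt t₀ t).hasDerivAt
  have hY'c : Continuous Y' := continuous_iff_continuousAt.2 fun t => (hY' t).continuousAt
  have hW2 : ∀ t, HasDerivAt (fun t => (W' t : Config n d)) (S.accel (yc t)) t := fun t =>
    V.subtypeL.hasFDerivAt.comp_hasDerivAt t (hW' t)
  have hY2 : ∀ t, HasDerivAt (fun t => (Y' t : Config n d)) (W' t : Config n d) t := fun t =>
    V.subtypeL.hasFDerivAt.comp_hasDerivAt t (hY' t)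
  have hac : Continuous fun t => S.accel (yc t) := S.continuous_accel_comp hycc hfc
  set D : ℝ → Config n d := fun t => y t - Y' t with hD
  have hDc : ContinuousOn D (Icc t₀ t₁) :=
    hyc.sub (continuous_subtype_val.comp hY'c).continuousOn
  have hDV : ∀ t ∈ Icc t₀ t₁, D t ∈ V := fun t ht => V.sub_mem (hker t ht) (Y' t).2
  have haff : ∀ w ∈ V, ∃ c k, EqOn (fun t => S.massForm w (D t)) (fun t => c + k * t)
      (Icc t₀ t₁) := by
    intro w hw
    refine exists_eqOn_affine_of_integral_deriv_deriv_mul_eq_zero hlt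
      ((S.massForm w).continuous.comp_continuousOn hDc) fun η hη => ?_
    have hcr := hcrit.integral_eq_zero hlt.le hfree hv (φ := fun t => η t • w)
      (φ' := fun t => deriv η t • w)
      (fun t => ((hη.contDiff.differentiable (by simp) t).hasDerivAt).smul_const w)
      (hη.deriv.continuous.smul continuous_const) (smul_mem_pathSpace hlt.le hη hw)
    have hyi := hη.deriv.deriv.integrable_smul (integrable_Ioo_of_continuousOn hyc)
    have hYi : Integrable (fun t => deriv (deriv η) t • (Y' t : Config n d))
        (volume.restrict (Ioo t₀ t₁)) :=
      hη.deriv.deriv.integrable_smul (integrable_Ioo_of_continuousOn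
      (continuous_subtype_val.comp hY'c).continuousOn)
    have hvi := hη.deriv.integrable_smul hv.integrable
    have hai := hη.integrable_smul (integrable_Ioo_of_continuousOn hac.continuousOn)
    have e1 := hv.1 (deriv η) hη.deriv.contDiff hη.deriv.hasCompactSupport
      hη.deriv.tsupport_subset
    have e2 := hη.deriv.integral_deriv_smul hlt.le hY2 (continuous_subtype_val.comp hW'c)
    have e3 := hη.integral_deriv_smul hlt.le hW2 hac
    have e4 : S.massForm w (∫ t in Ioo t₀ t₁, deriv η t • v t) +
        S.massForm w (∫ t in Ioo t₀ t₁, η t • S.accel (yc t)) = 0 := by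
      rw [← ContinuousLinearMap.integral_comp_comm _ hvi,
        ← ContinuousLinearMap.integral_comp_comm _ hai,
        ← integral_add ((S.massForm w).integrable_comp hvi) ((S.massForm w).integrable_comp hai),
        ← hcr]
      refine setIntegral_congr_fun measurableSet_Ioo fun t ht => ?_
      simp only [map_smul, hyeq t (Ioo_subset_Icc_self ht), S.massForm_comm w, smul_apply]
    calc ∫ t in Ioo t₀ t₁, deriv (deriv η) t * S.massForm w (D t)
        = ∫ t in Ioo t₀ t₁, S.massForm w (deriv (deriv η) t • y t -
            deriv (deriv η) t • (Y' t : Config n d)) := by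
          congr 1; ext t; rw [← smul_sub, map_smul, smul_eq_mul]
      _ = 0 := by
          have e6 := ContinuousLinearMap.integral_comp_comm (S.massForm w) (hyi.sub hYi)
          simp only [Pi.sub_apply] at e6
          rw [e6, integral_sub hyi hYi, e1]
          have e5 : ∫ t in Ioo t₀ t₁, deriv (deriv η) t • (Y' t : Config n d) =
              ∫ t in Ioo t₀ t₁, η t • S.accel (yc t) := by
            rw [e2]
            exact neg_eq_iff_eq_neg.2 e3
          rw [e5, map_sub, map_neg]
          linarith
  have hm₀ : t₀ ∈ Icc t₀ t₁ := left_mem_Icc.2 hlt.le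
  have hm₁ : t₁ ∈ Icc t₀ t₁ := right_mem_Icc.2 hlt.le
  have hne : t₁ - t₀ ≠ 0 := by linarith
  -- `K` is the slope of the chord. Pairings of `D` with vectors of `V` are affine, so the gap `w`
  -- between `D` and its chord is orthogonal to every vector of `V`, in particular to itself.
  set K : Config n d := (t₁ - t₀)⁻¹ • (D t₁ - D t₀) with hK
  have hKV : K ∈ V := V.smul_mem _ (V.sub_mem (hDV _ hm₁) (hDV _ hm₀))
  have hDeq : ∀ t ∈ Icc t₀ t₁, D t = D t₀ + (t - t₀) • K := by
    intro t ht
    rw [← sub_eq_zero]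
    set w := D t - (D t₀ + (t - t₀) • K) with hw
    have hwV : w ∈ V :=
      V.sub_mem (hDV t ht) (V.add_mem (hDV _ hm₀) (V.smul_mem _ hKV))
    obtain ⟨c, k, hck⟩ := haff w hwV
    have h1 := hck ht
    have h2 := hck hm₀
    have h3 := hck hm₁
    simp only at h1 h2 h3
    refine S.massForm_self_eq_zero ?_
    have : S.massForm w w = S.massForm w (D t) - (S.massForm w (D t₀) +
        (t - t₀) * ((t₁ - t₀)⁻¹ * (S.massForm w (D t₁) - S.massForm w (D t₀)))) := by
      nth_rw 2 [hw]
      simp only [hK, map_sub, map_add, map_smul, smul_eq_mul]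
    rw [this, h1, h2, h3]
    field_simp
    ring
  refine ⟨fun t => Y' t + (D t₀ + (t - t₀) • K), fun t => W' t + K, fun t => S.accel (yc t),
    fun t ht => ?_, fun t => ?_, fun t => ?_, hac, fun t ht => ?_, fun t => ?_⟩
  · simp only
    rw [← hDeq t ht, hD]; simp
  · have := (((hasDerivAt_id t).sub_const t₀).smul_const K).const_add (D t₀)
    rw [one_smul] at this
    exact (hY2 t).add this
  · exact (hW2 t).add_const K
  · simp only [hyeq t ht]
  · exact V.add_mem (W' t).2 hKV

/-- The natural boundary conditions of a critical point. -/
theorem IsCriticalPoint.massForm_boundary (hcrit : S.IsCriticalPoint t₀ t₁ y) (hlt : t₀ < t₁)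
    (hfree : ∀ t ∈ Icc t₀ t₁, CollisionFree (y t)) {Y W A : ℝ → Config n d}
    (hYy : EqOn Y y (Icc t₀ t₁)) (hY : ∀ t, HasDerivAt Y (W t) t)
    (hW : ∀ t, HasDerivAt W (A t) t) (hA : Continuous A)
    (hAy : ∀ t ∈ Icc t₀ t₁, A t = S.accel (y t)) {a b : Config n d}
    (ha : a ∈ S.fixedSpace S.τ.ker) (hb : b ∈ S.fixedSpace S.τ.ker)
    (hcyc : S.IsCyclicType → ∀ g, S.IsTimeImage g t₀ t₁ → S.act g a = b)
    (hdih : ¬ S.IsCyclicType →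
      a ∈ S.fixedSpace (S.isotropy t₀) ∧ b ∈ S.fixedSpace (S.isotropy t₁)) :
    S.massForm (W t₁) b = S.massForm (W t₀) a := by
  have hne : t₁ - t₀ ≠ 0 := by linarith
  have hWc : Continuous W := continuous_iff_continuousAt.2 fun t => (hW t).continuousAt
  -- The affine path from `a` to `b` is an admissible variation. By Newton's equation the first
  -- variation along it is the integral of the derivative of `S.massForm (W t) (φ t)`.
  set φ : ℝ → Config n d := fun t => a + (t - t₀) • (t₁ - t₀)⁻¹ • (b - a) with hφdef
  have hφ : ∀ t, HasDerivAt φ ((t₁ - t₀)⁻¹ • (b - a)) t := fun t => by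
    have := (((hasDerivAt_id t).sub_const t₀).smul_const ((t₁ - t₀)⁻¹ • (b - a))).const_add a
    rwa [one_smul] at this
  have hφc : Continuous φ := continuous_iff_continuousAt.2 fun t => (hφ t).continuousAt
  have hφ0 : φ t₀ = a := by simp [hφdef]
  have hφ1 : φ t₁ = b := by simp [hφdef, smul_smul, mul_inv_cancel₀ hne]
  have hmem : φ ∈ S.pathSpace t₀ t₁ := by
    refine ⟨memH1_of_hasDerivAt hlt.le hφ continuous_const, fun t _ => ?_, ?_, ?_⟩
    · exact (S.fixedSubmodule _).add_mem ha
        ((S.fixedSubmodule _).smul_mem _ ((S.fixedSubmodule _).smul_mem _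
          ((S.fixedSubmodule _).sub_mem hb ha)))
    · rw [hφ0, hφ1]; exact hcyc
    · rw [hφ0, hφ1]; exact hdih
  have hv : IsL2WeakDerivOn t₀ t₁ y W := by
    obtain ⟨h1, h2⟩ := isL2WeakDerivOn_of_hasDerivAt hlt.le hY hWc
    refine ⟨fun η hη1 hη2 hη3 => ?_, h2⟩
    rw [← h1 η hη1 hη2 hη3]
    exact setIntegral_congr_fun measurableSet_Ioo fun t ht => by
      simp only [hYy (Ioo_subset_Icc_self ht)]
  have h0 := hcrit.integral_eq_zero hlt.le hfree hv hφ continuous_const hmem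
  have h1 : ∫ t in Ioo t₀ t₁, (S.massForm (W t) ((t₁ - t₀)⁻¹ • (b - a)) +
      S.massForm (A t) (φ t)) = 0 := by
    rw [← h0]
    exact setIntegral_congr_fun measurableSet_Ioo fun t ht => by
      simp only [hAy t (Ioo_subset_Icc_self ht)]
  rw [setIntegral_Ioo_eq_intervalIntegral hlt.le,
    intervalIntegral.integral_eq_sub_of_hasDerivAt (f := fun t => S.massForm (W t) (φ t)), hφ0,
    hφ1] at h1
  · linarith
  · intro t _
    have := (S.massForm.hasFDerivAt.comp_hasDerivAt t (hW t)).clm_apply (hφ t)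
    rwa [add_comm] at this
  · refine Continuous.intervalIntegrable ?_ _ _
    exact ((S.massForm.continuous.comp hWc).clm_apply continuous_const).add
      ((S.massForm.continuous.comp hA).clm_apply hφc)

theorem eq_zero_of_massForm_eq_zero (g : G) {u : Config n d}
    (hu : u ∈ S.fixedSpace S.τ.ker)
    (h : ∀ a ∈ S.fixedSpace S.τ.ker, S.massForm u (S.act g a) = 0) : u = 0 := by
  refine S.massForm_self_eq_zero ?_
  have := h _ (S.act_mem_fixedSpace g⁻¹ hu)
  rwa [act_act_inv] at this

theorem act_eq_act_of_mem_ker {g h : G} (hgh : g⁻¹ * h ∈ S.τ.ker) {u : Config n d}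
    (hu : u ∈ S.fixedSpace S.τ.ker) : S.act h u = S.act g u := by
  have := hu.2 _ hgh
  rw [act_mul] at this
  rw [← S.act_act_inv g (S.act h u), this]

/-- Taking end values `a` and `g a`, the boundary identity and the invariance of the mass form show
that the difference of the two velocities is orthogonal to every `g a`, hence zero. -/
theorem ShiftsTime.act_velocity {g : G} (hS : S.IsCyclicType) (hg : S.ShiftsTime g (t₁ - t₀))
    {W : ℝ → Config n d} (hW : ∀ t, W t ∈ S.fixedSpace S.τ.ker)
    (hbd : ∀ a ∈ S.fixedSpace S.τ.ker, ∀ b ∈ S.fixedSpace S.τ.ker,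
      (S.IsCyclicType → ∀ g, S.IsTimeImage g t₀ t₁ → S.act g a = b) →
      (¬ S.IsCyclicType →
        a ∈ S.fixedSpace (S.isotropy t₀) ∧ b ∈ S.fixedSpace (S.isotropy t₁)) →
      S.massForm (W t₁) b = S.massForm (W t₀) a) : S.act g (W t₀) = W t₁ := by
  rw [eq_comm, ← sub_eq_zero]
  refine eq_zero_of_massForm_eq_zero g
    ((S.fixedSubmodule _).sub_mem (hW t₁) (S.act_mem_fixedSpace g (hW t₀))) fun a ha => ?_
  have := hbd a ha (S.act g a) (S.act_mem_fixedSpace g ha) (fun _ h hh => ?_)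
    (fun h => absurd hS h)
  · rw [map_sub, sub_apply, massForm_act, this, sub_self]
  · obtain ⟨c, hc⟩ := hS.exists_shiftsTime h
    have h1 := (hc.of_isTimeImage hh).mul hg.inv
    rw [add_neg_cancel] at h1
    exact act_eq_act_of_mem_ker h1.mem_ker ha

/-- The isotropy group consists of `ker τ` and the coset of `g`, and `g` acts as an involution on
`w`. So `w + g w` is an admissible end value and is orthogonal to `w`; its square norm is twice that
pairing. -/
theorem FlipsTime.act_velocity {g : G} {t : ℝ} (hg : S.FlipsTime g (2 * t)) {w : Config n d}
    (hw : w ∈ S.fixedSpace S.τ.ker)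
    (hbd : ∀ b ∈ S.fixedSpace (S.isotropy t), S.massForm w b = 0) : S.act g w = -w := by
  have hgg : S.act g (S.act g w) = w := by
    have := (hg.mul hg)
    rw [sub_self] at this
    rw [← act_mul]
    exact hw.2 _ this.mem_ker
  have hgw := S.act_mem_fixedSpace g hw
  have hsum : w + S.act g w ∈ S.fixedSpace S.τ.ker := (S.fixedSubmodule _).add_mem hw hgw
  have hfix : w + S.act g w ∈ S.fixedSpace (S.isotropy t) := by
    refine ⟨hsum.1, fun h hh => ?_⟩
    have hht : S.IsTimeImage h t t := Eq.symm hh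
    rcases S.shiftsTime_or_flipsTime h with ⟨c, hc⟩ | ⟨c, hc⟩
    · have := hc.of_isTimeImage hht
      rw [sub_self] at this
      exact hsum.2 h this.mem_ker
    · have h1 := hc.of_isTimeImage hht
      rw [← two_mul] at h1
      have hgi : S.FlipsTime g⁻¹ (2 * t) := fun s => by simpa using (hg (2 * t - s)).inv
      have h2 := h1.mul hgi
      rw [sub_self] at h2
      rw [act_eq_act_of_mem_ker h2.mem_ker hsum, act_add, hgg, add_comm]
  have h1 := hbd _ hfix
  rw [map_add] at h1
  have h2 : S.massForm (w + S.act g w) (w + S.act g w) = 0 := by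
    simp only [map_add, add_apply, massForm_act, S.massForm_comm _ w]
    linarith
  have := S.massForm_self_eq_zero h2
  rw [add_comm] at this
  exact eq_neg_of_add_eq_zero_left this

end SymmetricSystem
end NBody

/-! ### Gluing equivariant copies -/

namespace NBody
namespace SymmetricSystem

variable {G : Type*} [Group G] {n d : ℕ} {S : SymmetricSystem G n d} {t₀ t₁ : ℝ}

variable (S) in
/-- Paths on which a time-reversing group element `g` acts as `κ g`: `κ = 1` for equivariant loops
and `κ = -1` for their velocities. -/
structure IsTwistedEquivariant (κ : ℝ) (X : ℝ → Config n d) : Prop where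
  shift : ∀ g c, S.ShiftsTime g c → ∀ t, X (c + t) = S.act g (X t)
  flip : ∀ g c, S.FlipsTime g c → ∀ t, X (c - t) = κ • S.act g (X t)

theorem IsTwistedEquivariant.hasDerivAt_shift {κ : ℝ} {X : ℝ → Config n d}
    (hX : S.IsTwistedEquivariant κ X) {g : G} {c t : ℝ} (hg : S.ShiftsTime g c)
    {v : Config n d} (hv : HasDerivAt X v t) : HasDerivAt X (S.act g v) (c + t) := by
  have h1 : HasDerivAt (fun s => S.actCLM g (X (s - c))) (S.actCLM g v) (c + t) := by
    refine (S.actCLM g).hasFDerivAt.comp_hasDerivAt _ ?_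
    refine HasDerivAt.comp_sub_const (c + t) c ?_
    rwa [add_sub_cancel_left]
  refine h1.congr_of_eventuallyEq (Filter.Eventually.of_forall fun s => ?_)
  simp only [actCLM_apply, ← hX.shift g c hg, add_sub_cancel]

theorem IsTwistedEquivariant.hasDerivAt_flip {κ : ℝ} {X : ℝ → Config n d}
    (hX : S.IsTwistedEquivariant κ X) {g : G} {c t : ℝ} (hg : S.FlipsTime g c)
    {v : Config n d} (hv : HasDerivAt X v t) : HasDerivAt X (-κ • S.act g v) (c - t) := by
  have h1 : HasDerivAt (fun s => κ • S.actCLM g (X (c - s))) (κ • S.actCLM g (-v)) (c - t) := by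
    refine HasDerivAt.const_smul κ ((S.actCLM g).hasFDerivAt.comp_hasDerivAt _ ?_)
    refine HasDerivAt.comp_const_sub c (c - t) ?_
    rwa [sub_sub_cancel]
  rw [actCLM_apply, act_neg, smul_neg, ← neg_smul] at h1
  refine h1.congr_of_eventuallyEq (Filter.Eventually.of_forall fun s => ?_)
  simp only [actCLM_apply, ← hX.flip g c hg, sub_sub_cancel]

/-- Reversing time changes the sign of a derivative. Tracking it by `κ` lets the same gluing lemma
serve for the path and for its velocity. -/
theorem IsTwistedEquivariant.deriv {κ : ℝ} {X : ℝ → Config n d}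
    (hX : S.IsTwistedEquivariant κ X) (hd : Differentiable ℝ X) :
    S.IsTwistedEquivariant (-κ) (deriv X) where
  shift _ _ hg t := (hX.hasDerivAt_shift hg (hd t).hasDerivAt).deriv
  flip _ _ hg t := (hX.hasDerivAt_flip hg (hd t).hasDerivAt).deriv

theorem hasDerivAt_of_eqOn_Icc {E : Type*} [NormedAddCommGroup E] [NormedSpace ℝ E]
    {X P Q : ℝ → E} {v : E} {a s b : ℝ} (ha : a < s) (hb : s < b)
    (hP : HasDerivAt P v s) (hQ : HasDerivAt Q v s) (hXP : EqOn X P (Icc a s))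
    (hXQ : EqOn X Q (Icc s b)) : HasDerivAt X v s := by
  have h1 : HasDerivWithinAt X v (Icc a s) s :=
    hP.hasDerivWithinAt.congr hXP (hXP (right_mem_Icc.2 ha.le))
  have h2 : HasDerivWithinAt X v (Icc s b) s :=
    hQ.hasDerivWithinAt.congr hXQ (hXQ (left_mem_Icc.2 hb.le))
  have h3 := h1.union h2
  rw [Icc_union_Icc_eq_Icc ha.le hb.le] at h3
  exact h3.hasDerivAt (Icc_mem_nhds ha hb)

variable [Finite G]

theorem IsFundamentalDomain.exists_shiftsTime_or_flipsTime (hI : S.IsFundamentalDomain t₀ t₁)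
    (s : ℝ) : ∃ t ∈ Icc t₀ t₁, ∃ g, (∃ c, S.ShiftsTime g c ∧ s = c + t) ∨
      ∃ c, S.FlipsTime g c ∧ s = c - t := by
  obtain ⟨g, t, ht, hi⟩ := hI.exists_isTimeImage s
  refine ⟨t, ht, g, ?_⟩
  rcases S.shiftsTime_or_flipsTime g with ⟨c, hc⟩ | ⟨c, hc⟩
  · exact Or.inl ⟨_, hc.of_isTimeImage hi, by ring⟩
  · exact Or.inr ⟨_, hc.of_isTimeImage hi, by ring⟩

theorem IsTwistedEquivariant.ext_of_eqOn {κ : ℝ} {X X' : ℝ → Config n d}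
    (hI : S.IsFundamentalDomain t₀ t₁) (hX : S.IsTwistedEquivariant κ X)
    (hX' : S.IsTwistedEquivariant κ X') (h : EqOn X X' (Icc t₀ t₁)) : X = X' := by
  ext1 s
  obtain ⟨t, ht, g, ⟨c, hc, rfl⟩ | ⟨c, hc, rfl⟩⟩ := hI.exists_shiftsTime_or_flipsTime s
  · rw [hX.shift g c hc, hX'.shift g c hc, h ht]
  · rw [hX.flip g c hc, hX'.flip g c hc, h ht]

theorem IsTwistedEquivariant.differentiable {κ : ℝ} {X : ℝ → Config n d}
    (hI : S.IsFundamentalDomain t₀ t₁) (hX : S.IsTwistedEquivariant κ X)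
    (h : ∀ t ∈ Icc t₀ t₁, DifferentiableAt ℝ X t) : Differentiable ℝ X := by
  intro s
  obtain ⟨t, ht, g, ⟨c, hc, rfl⟩ | ⟨c, hc, rfl⟩⟩ := hI.exists_shiftsTime_or_flipsTime s
  · exact (hX.hasDerivAt_shift hc (h t ht).hasDerivAt).differentiableAt
  · exact (hX.hasDerivAt_flip hc (h t ht).hasDerivAt).differentiableAt

/-- A twisted equivariant path is differentiable on the closed fundamental domain if its one-sided
derivatives at the endpoints are compatible with the symmetry. -/
theorem IsTwistedEquivariant.hasDerivAt {κ : ℝ} {X Z Z' : ℝ → Config n d}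
    (hI : S.IsFundamentalDomain t₀ t₁) (hX : S.IsTwistedEquivariant κ X)
    (hXZ : EqOn X Z (Icc t₀ t₁)) (hZ : ∀ t, HasDerivAt Z (Z' t) t)
    (hshift : S.IsCyclicType → ∀ g, S.ShiftsTime g (t₁ - t₀) → S.act g (Z' t₀) = Z' t₁)
    (hflip : ¬ S.IsCyclicType → ∀ g, ∀ t ∈ ({t₀, t₁} : Set ℝ), S.FlipsTime g (2 * t) →
      -κ • S.act g (Z' t) = Z' t) :
    ∀ t ∈ Icc t₀ t₁, HasDerivAt X (Z' t) t := by
  have hlt := hI.lt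
  have hshiftQ : ∀ g c, S.ShiftsTime g c → ∀ t, HasDerivAt (fun s => S.actCLM g (Z (s - c)))
      (S.act g (Z' (t - c))) t := fun g c _ t =>
    (S.actCLM g).hasFDerivAt.comp_hasDerivAt _ (HasDerivAt.comp_sub_const t c (hZ _))
  have hflipQ : ∀ g t, HasDerivAt (fun s => κ • S.actCLM g (Z (2 * t - s)))
      (-κ • S.act g (Z' t)) t := fun g t => by
    have h1 : HasDerivAt (fun s => Z (2 * t - s)) (-Z' t) t := by
      refine HasDerivAt.comp_const_sub (2 * t) t ?_
      rw [two_mul, add_sub_cancel_right]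
      exact hZ t
    have := HasDerivAt.const_smul κ ((S.actCLM g).hasFDerivAt.comp_hasDerivAt t h1)
    rwa [actCLM_apply, act_neg, smul_neg, ← neg_smul] at this
  have hshiftX : ∀ g c, S.ShiftsTime g c → ∀ s, s - c ∈ Icc t₀ t₁ →
      X s = S.actCLM g (Z (s - c)) := fun g c hg s hs => by
    rw [actCLM_apply, ← hXZ hs, ← hX.shift g c hg, add_sub_cancel]
  have hflipX : ∀ g c, S.FlipsTime g c → ∀ s, c - s ∈ Icc t₀ t₁ →
      X s = κ • S.actCLM g (Z (c - s)) := fun g c hg s hs => by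
    rw [actCLM_apply, ← hXZ hs, ← hX.flip g c hg, sub_sub_cancel]
  intro t ht
  rcases eq_endpoints_or_mem_Ioo_of_mem_Icc ht with rfl | rfl | hio
  -- To the left of `t₀` the path is the copy of `Z` carried by the inverse shift, or by the
  -- reflection at `t₀`. The compatibility hypothesis makes its derivative at the junction equal to
  -- that of `Z`; the other endpoint is symmetric.
  · by_cases hS : S.IsCyclicType
    · obtain ⟨g, hg⟩ := hI.exists_shiftsTime hS
      refine hasDerivAt_of_eqOn_Icc (a := t - (t₁ - t)) (b := t₁) (by linarith) hlt
        (P := fun s => S.actCLM g⁻¹ (Z (s - -(t₁ - t)))) ?_ (hZ t) (fun s hs => ?_) hXZ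
      · have := hshiftQ _ _ hg.inv t
        rwa [show t - -(t₁ - t) = t₁ by ring, ← hshift hS g hg, act_inv_act] at this
      · exact hshiftX _ _ hg.inv s ⟨by linarith [hs.1], by linarith [hs.2]⟩
    · obtain ⟨g, hg⟩ := (hI.2 hS).2.1.exists_flipsTime hS
      refine hasDerivAt_of_eqOn_Icc (a := t - (t₁ - t)) (b := t₁) (by linarith) hlt
        (P := fun s => κ • S.actCLM g (Z (2 * t - s))) ?_ (hZ t) (fun s hs => ?_) hXZ
      · have := hflipQ g t
        rwa [hflip hS g t (by simp) hg] at this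
      · exact hflipX _ _ hg s ⟨by linarith [hs.2], by linarith [hs.1]⟩
  · by_cases hS : S.IsCyclicType
    · obtain ⟨g, hg⟩ := hI.exists_shiftsTime hS
      refine hasDerivAt_of_eqOn_Icc (a := t₀) (b := t + (t - t₀)) hlt (by linarith)
        (Q := fun s => S.actCLM g (Z (s - (t - t₀)))) (hZ t) ?_ hXZ (fun s hs => ?_)
      · have := hshiftQ _ _ hg t
        rwa [sub_sub_cancel, hshift hS g hg] at this
      · exact hshiftX _ _ hg s ⟨by linarith [hs.1], by linarith [hs.2]⟩
    · obtain ⟨g, hg⟩ := (hI.2 hS).2.2.1.exists_flipsTime hS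
      refine hasDerivAt_of_eqOn_Icc (a := t₀) (b := t + (t - t₀)) hlt (by linarith)
        (Q := fun s => κ • S.actCLM g (Z (2 * t - s))) (hZ t) ?_ hXZ (fun s hs => ?_)
      · have := hflipQ g t
        rwa [hflip hS g t (by simp) hg] at this
      · exact hflipX _ _ hg s ⟨by linarith [hs.2], by linarith [hs.1]⟩
  · exact (hZ t).congr_of_eventuallyEq
      (Filter.eventuallyEq_of_mem (Icc_mem_nhds hio.1 hio.2) hXZ)

end SymmetricSystem
end NBody

/-! ### The symmetrised path is a classical solution -/

open NBody SymmetricSystem in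
/-- If `y` is a collision-free critical point of the action on a fundamental domain `[t₀, t₁]`, then
the symmetrised path `x` is the unique equivariant loop which restricts to `y` (that is,
`x = π⁻¹ y` for the restriction map `π`), and `x` is a classical solution of the `n`-body problem. -/
theorem mainTheorem1 {G : Type*} [Group G] [Finite G] {n d : ℕ} (hn : 2 ≤ n)
    (S : NBody.SymmetricSystem G n d) (t₀ t₁ : ℝ) (hI : S.IsFundamentalDomain t₀ t₁)
    (y : ℝ → NBody.Config n d)
    (hfree : ∀ t ∈ Set.Icc t₀ t₁, NBody.SymmetricSystem.CollisionFree (y t))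
    (hcrit : S.IsCriticalPoint t₀ t₁ y) :
    S.symmetrised t₀ t₁ y ∈ S.equivariantLoops ∧
    Set.EqOn (S.symmetrised t₀ t₁ y) y (Set.Icc t₀ t₁) ∧
    (∀ x ∈ S.equivariantLoops, Set.EqOn x y (Set.Icc t₀ t₁) → x = S.symmetrised t₀ t₁ y) ∧
    S.IsClassicalSolution (S.symmetrised t₀ t₁ y) := by
  have hlt := hI.lt
  have hy := hcrit.1
  obtain ⟨Y, W, A, hYy, hY, hW, hA, hAy, hWV⟩ := hcrit.exists_hasDerivAt hlt hfree
  set x := S.symmetrised t₀ t₁ y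
  have hxy : EqOn x y (Icc t₀ t₁) := hI.symmetrised_eqOn hy
  have hequiv : ∀ (g : G) (t s : ℝ), S.IsTimeImage g t s → x s = S.act g (x t) :=
    fun g t s hi => hI.symmetrised_equivariant hy hi
  have hx1 : S.IsTwistedEquivariant 1 x :=
    ⟨fun g c hc t => hequiv g _ _ (by rw [add_comm]; exact hc t),
      fun g c hc t => by rw [one_smul]; exact hequiv g _ _ (hc t)⟩
  have hbd : ∀ a ∈ S.fixedSpace S.τ.ker, ∀ b ∈ S.fixedSpace S.τ.ker,
      (S.IsCyclicType → ∀ g, S.IsTimeImage g t₀ t₁ → S.act g a = b) →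
      (¬ S.IsCyclicType →
        a ∈ S.fixedSpace (S.isotropy t₀) ∧ b ∈ S.fixedSpace (S.isotropy t₁)) →
      S.massForm (W t₁) b = S.massForm (W t₀) a := fun a ha b hb h1 h2 =>
    hcrit.massForm_boundary hlt hfree hYy hY hW hA hAy ha hb h1 h2
  have hkermono : ∀ t, ∀ b ∈ S.fixedSpace (S.isotropy t), b ∈ S.fixedSpace S.τ.ker :=
    fun t b hb => ⟨hb.1, fun h hh => hb.2 h (S.ker_le_isotropy t hh)⟩
  have hz : ∀ H : Subgroup G, (0 : Config n d) ∈ S.fixedSpace H := fun H =>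
    (S.fixedSubmodule H).zero_mem
  have hderiv : ∀ t ∈ Icc t₀ t₁, HasDerivAt x (W t) t := by
    refine hx1.hasDerivAt hI (hxy.trans hYy.symm) hY
      (fun hS g hg => hg.act_velocity hS hWV hbd) fun hS g t ht hg => ?_
    rw [neg_one_smul, neg_eq_iff_eq_neg]
    refine hg.act_velocity (hWV t) fun b hb => ?_
    rcases ht with rfl | rfl
    -- Outside the cyclic case the two end values are independent; setting the other one to zero
    -- isolates the condition at this endpoint.
    · have := hbd b (hkermono _ b hb) 0 (hz _) (fun h => absurd h hS) fun _ => ⟨hb, hz _⟩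
      rw [← this, map_zero]
    · have := hbd 0 (hz _) b (hkermono _ b hb) (fun h => absurd h hS) fun _ => ⟨hz _, hb⟩
      rw [this, map_zero]
  have hdiff : Differentiable ℝ x := hx1.differentiable hI fun t ht => (hderiv t ht).differentiableAt
  have hx2 := hx1.deriv hdiff
  have hderiv2 : ∀ t ∈ Icc t₀ t₁, HasDerivAt (deriv x) (A t) t := by
    refine hx2.hasDerivAt hI (fun t ht => (hderiv t ht).deriv) hW (fun hS g hg => ?_)
      fun hS g t ht hg => ?_
    -- No new boundary condition is needed for the accelerations: they are equivariant functions of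
    -- positions that already match.
    · rw [hAy _ (left_mem_Icc.2 hlt.le), hAy _ (right_mem_Icc.2 hlt.le), ← accel_act]
      have := hg t₀
      rw [add_sub_cancel] at this
      rw [hI.act_eq hy (left_mem_Icc.2 hlt.le) (right_mem_Icc.2 hlt.le) this]
    · have htI : t ∈ Icc t₀ t₁ := by
        rcases ht with rfl | rfl
        exacts [left_mem_Icc.2 hlt.le, right_mem_Icc.2 hlt.le]
      have := hg t
      rw [two_mul, add_sub_cancel_right] at this
      rw [neg_neg, one_smul, hAy t htI, ← accel_act, hI.act_eq hy htI htI this]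
  have hdiff2 : Differentiable ℝ (deriv x) :=
    hx2.differentiable hI fun t ht => (hderiv2 t ht).differentiableAt
  have hx3 : S.IsTwistedEquivariant 1 (deriv (deriv x)) := by
    have := hx2.deriv hdiff2
    rwa [neg_neg] at this
  have hacc : S.IsTwistedEquivariant 1 fun t => S.accel (x t) :=
    ⟨fun g c hc t => by rw [hx1.shift g c hc, accel_act],
      fun g c hc t => by rw [hx1.flip g c hc, one_smul, one_smul, accel_act]⟩
  have hnewton : deriv (deriv x) = fun t => S.accel (x t) :=
    hx3.ext_of_eqOn hI hacc fun t ht => by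
      rw [(hderiv2 t ht).deriv, hAy t ht, ← hxy ht]
  have hxfree : ∀ t, CollisionFree (x t) := by
    intro s
    obtain ⟨g, t, ht, hi⟩ := hI.exists_isTimeImage s
    rw [hequiv g t s hi, hxy ht]
    exact S.collisionFree_act g (hfree t ht)
  have hconf : ∀ t, x t ∈ S.configSpace := by
    intro s
    obtain ⟨g, t, ht, hi⟩ := hI.exists_isTimeImage s
    rw [hequiv g t s hi, hxy ht]
    exact S.act_mem_configSpace g (hy.2.1 t ht).1
  refine ⟨⟨⟨fun t => ?_, ?_, hconf⟩, fun g t s hi => ?_⟩, hxy, fun x' hx' hxy' => ?_, ?_, hxfree,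
    fun t i => ?_⟩
  · have := hequiv 1 t (t + S.T) (by simpa using S.isTimeImage_one_int t 1)
    rwa [act_one] at this
  · exact memH1_of_hasDerivAt S.T_pos.le (fun t => (hdiff t).hasDerivAt) hdiff2.continuous
  · rw [hequiv g⁻¹ t s hi, act_act_inv]
  · ext1 s
    obtain ⟨g, t, ht, hi⟩ := hI.exists_isTimeImage s
    rw [hequiv g t s hi, hxy ht, ← hxy' ht]
    exact (hx'.2 g s t hi.inv).symm
  · rw [show (2 : WithTop ℕ∞) = 1 + 1 by norm_num, contDiff_succ_iff_deriv]
    refine ⟨hdiff, by simp, ?_⟩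
    rw [contDiff_one_iff_deriv]
    refine ⟨hdiff2, ?_⟩
    -- Continuity of the second derivative comes from Newton's equation, the acceleration being
    -- continuous off collisions.
    rw [hnewton]
    exact S.continuous_accel_comp hdiff.continuous hxfree
  · have h1 : (deriv fun s => x s i) = fun s => deriv x s i :=
      funext fun s => (hasDerivAt_pi.1 (hdiff s).hasDerivAt i).deriv
    have h2 : deriv (fun s => deriv x s i) t = deriv (deriv x) t i :=
      (hasDerivAt_pi.1 (hdiff2 t).hasDerivAt i).deriv
    rw [h1, h2, hnewton, S.gradient_potential_update (hxfree t) i]
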